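/- All quantum systems are nonzero finite-dimensional Hilbert spaces $\mathbb C^{A}$ with fixed standard bases; $AB$ denotes the tensor product of $A$ and $B$, $\mathfrak S(A)$ the set of states (positive semidefinite operators of trace one) on $A$, and $\mathcal C(A,B)$ the set of channels (completely positive trace preserving linear maps $\mathcal B(A)\to\mathcal B(B)$). For a linear map $\varphi:\mathcal B(A)\to\mathcal B(B)$ let $\|\varphi\|_\diamond=\max_{\rho\in\mathfrak S(AA)}\|(\varphi\otimes id_A)(\rho)\|_1$, let $\varphi^*$ be given by $\mathrm{Tr}[X\varphi^*(Y)]=\mathrm{Tr}[\varphi(X)Y]$, and put $\varphi^{\mathsf T}(Y)=(\varphi^*(Y^{\mathsf T}))^{\mathsf T}$. For a self-adjoint operator $X$ on $AB$ put $$\|X\|^\diamond_{B|A}=\max\{\langle X,\varphi\rangle:\ -\beta\le\varphi\le\beta\text{ for some }\beta\in\mathcal C(A,B)\},\qquad \langle X,\varphi\rangle=\sum_{i,j}\langle ii|(\varphi\otimes id_B)(X)|jj\rangle ,$$ where $\varphi$ ranges over linear maps $\mathcal B(A)\to\mathcal B(B)$ and $\varphi\le\beta$ means that $\beta-\varphi$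 is completely positive. (This is the dual norm of $\|\cdot\|_\diamond$, and for $X\ge0$ it equals $2^{-H_{\min}(B|A)_X}$, with $H_{\min}$ the conditional min-entropy.) For an ensemble $\mathcal E=\{\lambda_i,\rho_i\}_{i=1}^k$ of states on $A$ and a measurement $M=\{M_i\}_{i=1}^k$ on $A$ ($M_i\ge0$, $\sum_iM_i=I$) put $P_{\mathrm{succ}}(\mathcal E,M)=\sum_i\lambda_i\mathrm{Tr}[\rho_iM_i]$ and $P_{\mathrm{succ}}(\mathcal E)=\max_MP_{\mathrm{succ}}(\mathcal E,M)$. For a channel $\Phi\in\mathcal C(B,A_1)$, an ensemble $\mathcal E$ on $R_0A_1$ and a measurement $M$ on $A_1A_1$ with as many outcomes as $\mathcal E$ has members put $$P^{\mathcal C(R_0,B),\Phi,\{M\}}_{\mathrm{succ}}(\mathcal E)=\sup_{\alpha\in\mathcal C(R_0,B)}P_{\mathrm{succ}}\big((\alpha\otimes id_{A_1})(\mathcal E),(\Phi^*\otimes id_{A_1})(M)\big).$$ **Theorem.** Let $\Phi_1\in\mathcal C(A_0,A_1)$, $\Phi_2\in\mathcal C(A_0',A_1)$ and $\epsilon\ge0$.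 The minimum $\delta_{\mathrm{pre}}(\Phi_1\|\Phi_2)=\min_{\Lambda\in\mathcal C(A_0',A_0)}\|\Phi_1\circ\Lambda-\Phi_2\|_\diamond$ exists, and the following are equivalent: (i) $\delta_{\mathrm{pre}}(\Phi_1\|\Phi_2)\le\epsilon$; (ii) for every ancilla $R_0$ and every $\rho\in\mathfrak S(R_0A_1)$, $$\|(id_{R_0}\otimes\Phi_2^{\mathsf T})(\rho)\|^\diamond_{A_0'|R_0}\le\|(id_{R_0}\otimes\Phi_1^{\mathsf T})(\rho)\|^\diamond_{A_0|R_0}+\frac\epsilon2\|\rho\|^\diamond_{A_1|R_0};$$ (iii) for every ancilla $R_0$, every ensemble $\mathcal E$ on $R_0A_1$ and every measurement $M$ on $A_1A_1$ with as many outcomes as $\mathcal E$ has members, $$P^{\mathcal C(R_0,A_0'),\Phi_2,\{M\}}_{\mathrm{succ}}(\mathcal E)\le P^{\mathcal C(R_0,A_0),\Phi_1,\{M\}}_{\mathrm{succ}}(\mathcal E)+\frac\epsilon2P_{\mathrm{succ}}(\mathcal E).$$ Moreover, in (ii) and in (iii) it is enough to take $R_0\simeq A_0'$: each of the conditions so restricted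 is still equivalent to (i). -/

import Mathlib

/-! Finite-dimensional quantum systems are Hilbert spaces `ℂ^a` with a finite index type `a` for the
standard basis; operators are complex matrices, and the composite of `a` and `b` is indexed by
`a × b`. -/

universe u v w

open scoped ComplexOrder

noncomputable section

namespace QChan

variable {a : Type u} {b : Type v} {r : Type w}

/-- Linear maps from operators on `a` to operators on `b`. -/
abbrev MatMap (a : Type u) (b : Type v) : Type (max u v) := Matrix a a ℂ →ₗ[ℂ] Matrix b b ℂ

/-- `(Φ ⊗ id_r)(X)` for an operator `X` on the composite system `a r`. -/
def tensorId (Φ : MatMap a b) (X : Matrix (a × r) (a × r) ℂ) : Matrix (b × r) (b × r) ℂ :=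
  Matrix.of fun p q => Φ (Matrix.of fun i j => X (i, p.2) (j, q.2)) p.1 q.1

/-- `(id_r ⊗ Φ)(X)` for an operator `X` on the composite system `r a`. -/
def idTensor (Φ : MatMap a b) (X : Matrix (r × a) (r × a) ℂ) : Matrix (r × b) (r × b) ℂ :=
  Matrix.of fun p q => Φ (Matrix.of fun i j => X (p.1, i) (q.1, j)) p.2 q.2

/-- On product operators `tensorId` is what it should be. -/
theorem tensorId_kronecker (Φ : MatMap a b) (X : Matrix a a ℂ) (Y : Matrix r r ℂ) :
    tensorId Φ (Matrix.kroneckerMap (· * ·) X Y) = Matrix.kroneckerMap (· * ·) (Φ X) Y := by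
  ext ⟨i, k⟩ ⟨j, l⟩
  have h : (Matrix.of fun i j => X i j * Y k l) = Y k l • X := by
    ext i j; simp [mul_comm]
  simp [tensorId, h, mul_comm]

/-- On product operators `idTensor` is what it should be. -/
theorem idTensor_kronecker (Φ : MatMap a b) (X : Matrix a a ℂ) (Y : Matrix r r ℂ) :
    idTensor Φ (Matrix.kroneckerMap (· * ·) Y X) = Matrix.kroneckerMap (· * ·) Y (Φ X) := by
  ext ⟨k, i⟩ ⟨l, j⟩
  have h : (Matrix.of fun i j => Y k l * X i j) = Y k l • X := by
    ext i j; simp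
  simp [idTensor, h]

/-- `Φ` is completely positive: `Φ ⊗ id_n` preserves positive semidefiniteness for every `n`. -/
def IsCP (Φ : MatMap a b) : Prop :=
  ∀ (n : ℕ) (X : Matrix (a × Fin n) (a × Fin n) ℂ), X.PosSemidef → (tensorId Φ X).PosSemidef

/-- Quantum channels: completely positive trace preserving maps. -/
def IsChannel [Fintype a] [Fintype b] (Φ : MatMap a b) : Prop :=
  IsCP Φ ∧ ∀ X : Matrix a a ℂ, (Φ X).trace = X.trace

/-- States: positive semidefinite operators of trace one. -/
def IsState [Fintype a] (ρ : Matrix a a ℂ) : Prop :=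
  ρ.PosSemidef ∧ ρ.trace = 1

/-- The trace norm `Tr √(Xᴴ X)`, the sum of the singular values of `X`. -/
def traceNorm [Fintype a] [DecidableEq a] (X : Matrix a a ℂ) : ℝ :=
  ∑ i, Real.sqrt ((Matrix.isHermitian_conjTranspose_mul_self X).eigenvalues i)

/-- The diamond norm: the supremum of `‖(φ ⊗ id_a)(ρ)‖₁` over all states `ρ` on `a a`. -/
def diamondNorm [Fintype a] [DecidableEq a] [Fintype b] [DecidableEq b] (φ : MatMap a b) : ℝ :=
  sSup {t : ℝ | ∃ ρ : Matrix (a × a) (a × a) ℂ, IsState ρ ∧ t = traceNorm (tensorId φ ρ)}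

/-- The adjoint `Φ*` for the trace pairing: `Tr[X Φ*(Y)] = Tr[Φ(X) Y]`. -/
def traceAdjoint [DecidableEq a] [Fintype b] (Φ : MatMap a b) : MatMap b a where
  toFun Y := Matrix.of fun i j => (Φ (Matrix.single j i 1) * Y).trace
  map_add' X Y := by ext i j; simp [Matrix.mul_add]
  map_smul' c X := by ext i j; simp

theorem trace_mul_traceAdjoint [Fintype a] [DecidableEq a] [Fintype b] (Φ : MatMap a b)
    (X : Matrix a a ℂ) (Y : Matrix b b ℂ) :
    (X * traceAdjoint Φ Y).trace = (Φ X * Y).trace := by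
  have hX : Φ X = ∑ i, ∑ j, X i j • Φ (Matrix.single i j 1) := by
    conv_lhs => rw [Matrix.matrix_eq_sum_single X]
    simp only [map_sum]
    refine Finset.sum_congr rfl fun i _ => Finset.sum_congr rfl fun j _ => ?_
    rw [← map_smul, Matrix.smul_single, smul_eq_mul, mul_one]
  rw [hX]
  simp only [Finset.sum_mul, Matrix.trace_sum, Matrix.smul_mul, Matrix.trace_smul, smul_eq_mul]
  simp [Matrix.trace, Matrix.mul_apply, traceAdjoint]

/-- The transposed map `Φᵀ(Y) = (Φ*(Yᵀ))ᵀ`, with transposes in the standard bases. -/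
def transposeMap [DecidableEq a] [Fintype b] (Φ : MatMap a b) : MatMap b a where
  toFun Y := (traceAdjoint Φ Y.transpose).transpose
  map_add' X Y := by simp
  map_smul' c X := by simp

/-- The duality `⟨X, φ⟩ = ⟪I_b| (φ ⊗ id_b)(X) |I_b⟫` between an operator `X` on `a b` and a map `φ`
from `a` to `b`, where `|I_b⟫ = ∑ i, |i⟩ ⊗ |i⟩`. -/
def pairing [Fintype b] (X : Matrix (a × b) (a × b) ℂ) (φ : MatMap a b) : ℂ :=
  ∑ i : b, ∑ j : b, tensorId φ X (i, i) (j, j)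

/-- The norm `‖X‖^⋄_{b|a}` of an operator `X` on `a b`: the supremum of `⟨X, φ⟩` over
all maps `φ` with `-β ≤ φ ≤ β` in the order of complete positivity for some channel `β`. -/
def dualNorm [Fintype a] [Fintype b] (X : Matrix (a × b) (a × b) ℂ) : ℝ :=
  sSup {t : ℝ | ∃ φ β : MatMap a b, IsChannel β ∧ IsCP (β - φ) ∧ IsCP (β + φ) ∧
    t = (pairing X φ).re}

/-- `{λ_i, ρ_i}` is an ensemble of states on `a`. -/
def IsEnsemble [Fintype a] {k : ℕ} (lam : Fin k → ℝ) (ρ : Fin k → Matrix a a ℂ) : Prop :=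
  (∀ i, 0 ≤ lam i) ∧ ∑ i, lam i = 1 ∧ ∀ i, IsState (ρ i)

/-- `M` is a measurement on `a`. -/
def IsMeasurement [DecidableEq a] {k : ℕ} (M : Fin k → Matrix a a ℂ) : Prop :=
  (∀ i, (M i).PosSemidef) ∧ ∑ i, M i = 1

/-- The success probability `∑ i, λ_i Tr[ρ_i M_i]` of an ensemble for a given measurement. -/
def succProb [Fintype a] {k : ℕ} (lam : Fin k → ℝ) (ρ M : Fin k → Matrix a a ℂ) : ℝ :=
  ∑ i, lam i * ((ρ i * M i).trace).re

/-- The optimal success probability of an ensemble, over all measurements. -/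
def optSuccProb [Fintype a] [DecidableEq a] {k : ℕ} (lam : Fin k → ℝ)
    (ρ : Fin k → Matrix a a ℂ) : ℝ :=
  sSup {t : ℝ | ∃ M : Fin k → Matrix a a ℂ, IsMeasurement M ∧ t = succProb lam ρ M}

/-- The optimal success probability of an ensemble on `r c` in the guessing game in which any
channel `α` from `r` to `a` may be applied, then the channel `Φ` from `a` to `b`, and then the fixed
measurement `M` on `b c`. -/
def preSuccProb {c : Type*} [Fintype r] [Fintype a] [DecidableEq a] [Fintype b] [Fintype c]
    (Φ : MatMap a b) {k : ℕ} (M : Fin k → Matrix (b × c) (b × c) ℂ)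
    (lam : Fin k → ℝ) (ρ : Fin k → Matrix (r × c) (r × c) ℂ) : ℝ :=
  sSup {t : ℝ | ∃ α : MatMap r a, IsChannel α ∧
    t = succProb lam (fun i => tensorId α (ρ i)) (fun i => tensorId (traceAdjoint Φ) (M i))}

/-- The distances `‖Φ₁ ∘ Λ - Φ₂‖_⋄` for all preprocessing channels `Λ`. -/
def preDistances {a' : Type*} [Fintype a] [Fintype a'] [DecidableEq a'] [Fintype b] [DecidableEq b]
    (Φ₁ : MatMap a b) (Φ₂ : MatMap a' b) : Set ℝ :=
  {d : ℝ | ∃ Λ : MatMap a' a, IsChannel Λ ∧ d = diamondNorm (Φ₁ ∘ₗ Λ - Φ₂)}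

/-- The preprocessing deficiency `δ_pre(Φ₁‖Φ₂)`. -/
def deltaPre {a' : Type*} [Fintype a] [Fintype a'] [DecidableEq a'] [Fintype b] [DecidableEq b]
    (Φ₁ : MatMap a b) (Φ₂ : MatMap a' b) : ℝ :=
  sInf (preDistances Φ₁ Φ₂)

end QChan

end

open scoped ComplexOrder

noncomputable section

namespace QChan

open scoped Pointwise

/-! ### Positive semidefinite matrices: compactness, separation, Jordan decomposition. -/

section PositiveSemidefinite

variable {n m : Type*}

/-! The pivot is the semidefinite form of the diamond norm: for channels `Ψ₁`, `Ψ₂`, half of `‖Ψ₁ -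
Ψ₂‖_⋄` is the least `c ≥ 0` such that `c β + Ψ₁ - Ψ₂` is completely positive for some channel `β`
(`traceNorm_tensorId_le`, `exists_isCP_dominating`). Hence (i) says that `Φ₂ ≤ Φ₁ ∘ Λ + (ε/2) β` for
some channels `Λ`, `β`; this is `DominatedUpTo`, by `deltaPre_le_iff`.

Composing this inequality with any channel `α` and applying a positive functional gives (ii) and
(iii), since `Λ ∘ α` and `β ∘ α` compete in the suprema on the right.

Conversely, the Choi operators of the maps `Φ₁ ∘ Λ + c β` form a compact convex set. By Hahn-Banach
separation (`exists_posSemidef_sub`) one of them dominates `Φ₂` as soon as this holds for each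
positive functional separately. Such functionals are pairings with multiples of states on `A₀' A₁`,
and maximizing over `Λ` and `β` produces the two dual norms on the right of (ii). The left side is
bounded below by the choice `α = id`, available for `R₀ = A₀'`; so that ancilla suffices.

For (iii) to (ii), rotate the second factor of a state by the discrete Weyl unitaries and measure in
the correspondingly rotated maximally entangled states. This one game turns (iii) into a positive
multiple of (ii) with the same ancilla (`dualNorm_le_of_preSuccProb_le`). -/

theorem trace_mul_nonneg [Fintype n] {A B : Matrix n n ℂ} (hA : A.PosSemidef)
    (hB : B.PosSemidef) : 0 ≤ (A * B).trace := by
  classical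
  open scoped MatrixOrder in
  obtain ⟨D, rfl⟩ := CStarAlgebra.nonneg_iff_eq_star_mul_self.mp hB.nonneg
  rw [← mul_assoc, Matrix.trace_mul_comm, ← mul_assoc, Matrix.star_eq_conjTranspose]
  exact (hA.mul_mul_conjTranspose_same D).trace_nonneg

theorem re_trace_mul_nonneg [Fintype n] {A B : Matrix n n ℂ} (hA : A.PosSemidef)
    (hB : B.PosSemidef) : 0 ≤ (A * B).trace.re :=
  (Complex.nonneg_iff.mp (trace_mul_nonneg hA hB)).1

theorem re_trace_nonneg [Fintype n] {A : Matrix n n ℂ} (hA : A.PosSemidef) : 0 ≤ A.trace.re :=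
  (Complex.nonneg_iff.mp hA.trace_nonneg).1

theorem trace_eq_re [Fintype n] {A : Matrix n n ℂ} (hA : A.PosSemidef) :
    A.trace = (A.trace.re : ℂ) :=
  Complex.ext rfl (by simpa using (Complex.nonneg_iff.mp hA.trace_nonneg).2.symm)

theorem posSemidef_real_smul {A : Matrix n n ℂ} (hA : A.PosSemidef) {c : ℝ} (hc : 0 ≤ c) :
    (c • A).PosSemidef := hA.smul hc

/-- The block sum is a congruence `Vᴴ N V`, where `V` stacks copies of the identity. -/
theorem posSemidef_sum_blocks [Fintype m] [Fintype n] {N : Matrix (m × n) (m × n) ℂ}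
    (hN : N.PosSemidef) : (Matrix.of fun p q : n => ∑ i, ∑ j, N (i, p) (j, q)).PosSemidef := by
  classical
  convert hN.conjTranspose_mul_mul_same
    (Matrix.of fun (p : m × n) (q : n) => if p.2 = q then (1 : ℂ) else 0) using 1
  ext p q
  simp only [Matrix.mul_apply, Fintype.sum_prod_type, Matrix.conjTranspose_apply, Matrix.of_apply,
    mul_ite, mul_one, mul_zero, apply_ite star, star_one, star_zero, ite_mul, one_mul, zero_mul,
    Finset.sum_ite_eq', Finset.mem_univ, if_true]
  exact Finset.sum_comm

/-- A 2 × 2 principal minor gives `|C p q|² ≤ C p p * C q q`, and each diagonal entry is at most the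
trace. This makes trace-bounded sets of positive matrices compact. -/
theorem norm_apply_le_trace [Fintype n] {C : Matrix n n ℂ} (hC : C.PosSemidef) (p q : n) :
    ‖C p q‖ ≤ C.trace.re := by
  classical
  have hd : ∀ i, 0 ≤ (C i i).re := fun i => (Complex.nonneg_iff.mp hC.diag_nonneg).1
  have him : ∀ i, (C i i).im = 0 := fun i => (Complex.nonneg_iff.mp hC.diag_nonneg).2.symm
  have hle : ∀ i, (C i i).re ≤ C.trace.re := fun i => by
    rw [Matrix.trace, Complex.re_sum]
    exact Finset.single_le_sum (f := fun i => (C i i).re) (fun j _ => hd j) (Finset.mem_univ i)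
  have hdet := (hC.submatrix ![p, q]).det_nonneg
  rw [Matrix.det_fin_two] at hdet
  have hqp : C q p = star (C p q) := (hC.1.apply q p).symm
  have h := (Complex.nonneg_iff.mp hdet).1
  simp only [Matrix.submatrix_apply, Matrix.cons_val_zero, Matrix.cons_val_one, hqp,
    Complex.star_def, Complex.mul_conj, Complex.sub_re, Complex.mul_re, him, Complex.ofReal_re,
    Complex.normSq_eq_norm_sq] at h
  have hT : 0 ≤ C.trace.re := (hd p).trans (hle p)
  refine abs_le_of_sq_le_sq' ?_ hT |>.2
  nlinarith [hd p, hd q, hle p, hle q, mul_le_mul (hle p) (hle q) (hd q) hT]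

theorem isClosed_posSemidef [Fintype n] : IsClosed {C : Matrix n n ℂ | C.PosSemidef} := by
  simp only [Matrix.posSemidef_iff_dotProduct_mulVec, Set.ofPred_and, Set.ofPred_forall]
  refine IsClosed.inter ?_ (isClosed_iInter fun x => ?_)
  · exact isClosed_eq (by fun_prop) continuous_id
  · exact isClosed_Ici.preimage (f := fun C : Matrix n n ℂ => dotProduct (star x) (C.mulVec x))
      (by fun_prop)

theorem isCompact_posSemidef_trace_le [Fintype n] (c : ℝ) :
    IsCompact {C : Matrix n n ℂ | C.PosSemidef ∧ C.trace.re ≤ c} := by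
  have hK : IsCompact {C : Matrix n n ℂ | ∀ p q, C p q ∈ Metric.closedBall (0 : ℂ) c} := by
    have := isCompact_univ_pi fun _ : n => isCompact_univ_pi fun _ : n =>
      isCompact_closedBall (0 : ℂ) c
    convert! this using 1
    ext C
    exact ⟨fun h p _ q _ => h p q, fun h p q => h p trivial q trivial⟩
  refine hK.of_isClosed_subset ?_ ?_
  · exact isClosed_posSemidef.inter (isClosed_le (f := fun C : Matrix n n ℂ => C.trace.re)
      (by fun_prop) continuous_const)
  · intro C hC p q
    simpa using (norm_apply_le_trace hC.1 p q).trans hC.2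

theorem exists_real_functional_eq_trace [Fintype n] (f : Matrix n n ℂ →ₗ[ℝ] ℝ) :
    ∃ R : Matrix n n ℂ, ∀ X, f X = (R * X).trace.re := by
  classical
  refine ⟨Matrix.of fun q p => (f (Matrix.single p q 1) : ℂ) -
    Complex.I * f (Complex.I • Matrix.single p q 1), fun X => ?_⟩
  conv_lhs => rw [Matrix.matrix_eq_sum_single X]
  simp only [map_sum, Matrix.trace, Matrix.diag_apply, Matrix.mul_apply, Complex.re_sum]
  rw [Finset.sum_comm]
  refine Finset.sum_congr rfl fun q _ => Finset.sum_congr rfl fun p _ => ?_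
  have h : Matrix.single p q (X p q) = (X p q).re • Matrix.single p q (1 : ℂ) +
      (X p q).im • (Complex.I • Matrix.single p q (1 : ℂ)) := by
    simp only [Matrix.smul_single, ← Matrix.single_add]
    congr 1
    simp [Complex.re_add_im]
  rw [h, map_add, map_smul, map_smul]
  simp
  ring

/-- A Hermitian matrix that is dominated in every positive functional by some member of a convex set
is dominated by a member of it. -/
theorem exists_posSemidef_sub [Fintype n] {K : Set (Matrix n n ℂ)} (hK : Convex ℝ K)
    (hKH : ∀ C ∈ K, C.IsHermitian) (hKc : ∀ c : ℝ, IsCompact (K ∩ {C | c ≤ C.trace.re}))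
    {H : Matrix n n ℂ} (hH : H.IsHermitian)
    (h : ∀ ρ : Matrix n n ℂ, ρ.PosSemidef → ∀ η > (0 : ℝ),
      ∃ C ∈ K, (ρ * H).trace.re ≤ (ρ * C).trace.re + η) :
    ∃ C ∈ K, (C - H).PosSemidef := by
  -- `S` is `K` minus the positive cone. If `H` were outside this closed convex set, a separating
  -- functional would contradict `h`.
  set S : Set (Matrix n n ℂ) := {H | ∃ C ∈ K, (C - H).PosSemidef} with hS
  have hSconv : Convex ℝ S := by
    rintro X ⟨C, hC, hCX⟩ Y ⟨D, hD, hDY⟩ s t hs ht hst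
    refine ⟨s • C + t • D, hK hC hD hs ht hst, ?_⟩
    have : s • C + t • D - (s • X + t • Y) = s • (C - X) + t • (D - Y) := by
      simp only [smul_sub]; abel
    rw [this]
    exact (posSemidef_real_smul hCX hs).add (posSemidef_real_smul hDY ht)
  have hScl : IsClosed S := by
    rw [← closure_subset_iff_isClosed]
    intro X hX
    -- Only upper trace slices of `K` are compact. Near `X` this is enough: a matrix dominating `Y`
    -- has at least the trace of `Y`, so locally `S` lies in a compact set plus a closed cone.
    have hU : IsOpen {Y : Matrix n n ℂ | X.trace.re - 1 < Y.trace.re} :=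
      isOpen_lt continuous_const (by fun_prop)
    have hX' : X ∈ closure ({Y : Matrix n n ℂ | X.trace.re - 1 < Y.trace.re} ∩ S) :=
      hU.inter_closure ⟨by simp, hX⟩
    have hcl : IsClosed (K ∩ {C | X.trace.re - 1 ≤ C.trace.re} +
        {P : Matrix n n ℂ | (-P).PosSemidef}) :=
      IsClosed.add_left_of_isCompact (isClosed_posSemidef.preimage continuous_neg) (hKc _)
    have hsub : {Y : Matrix n n ℂ | X.trace.re - 1 < Y.trace.re} ∩ S ⊆
        K ∩ {C | X.trace.re - 1 ≤ C.trace.re} + {P : Matrix n n ℂ | (-P).PosSemidef} := by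
      rintro Y ⟨hY, C, hC, hCY⟩
      have hY' : X.trace.re - 1 < Y.trace.re := hY
      have hCY' := re_trace_nonneg hCY
      rw [Matrix.trace_sub, Complex.sub_re] at hCY'
      have hle : X.trace.re - 1 ≤ C.trace.re := by linarith
      have hneg : (-(Y - C)).PosSemidef := by simpa using hCY
      exact Set.mem_add.mpr ⟨C, ⟨hC, hle⟩, Y - C, hneg, by abel⟩
    obtain ⟨C, hC, P, hP, hCP⟩ := Set.mem_add.mp (closure_minimal hsub hcl hX')
    have hCX : C - X = -P := by rw [← hCP]; abel
    exact ⟨C, hC.1, hCX ▸ hP⟩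
  by_contra hcon
  have : LocallyConvexSpace ℝ (Matrix n n ℂ) :=
    inferInstanceAs (LocallyConvexSpace ℝ (n → n → ℂ))
  obtain ⟨f, u, hfS, hfH⟩ := geometric_hahn_banach_closed_point (x := H) hSconv hScl hcon
  obtain ⟨R, hR⟩ := exists_real_functional_eq_trace (f : Matrix n n ℂ →ₗ[ℝ] ℝ)
  -- The separating functional is only real linear; on Hermitian matrices it is half the pairing
  -- with the Hermitian matrix `R + Rᴴ`.
  have hR' : ∀ X : Matrix n n ℂ, X.IsHermitian → ((R + R.conjTranspose) * X).trace.re = 2 * f X := by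
    intro X hX
    have h1 : (R.conjTranspose * X).trace.re = (R * X).trace.re := by
      have : R.conjTranspose * X = (X * R).conjTranspose := by
        rw [Matrix.conjTranspose_mul, hX.eq]
      rw [this, Matrix.trace_conjTranspose, Complex.star_def, Complex.conj_re,
        Matrix.trace_mul_comm]
    have h2 := hR X
    simp only [ContinuousLinearMap.coe_coe] at h2
    rw [Matrix.add_mul, Matrix.trace_add, Complex.add_re, h1, h2]
    ring
  obtain ⟨C₀, hC₀, -⟩ := h 0 .zero 1 one_pos
  have hfP : ∀ P : Matrix n n ℂ, P.PosSemidef → 0 ≤ f P := by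
    intro P hP
    by_contra hneg
    push Not at hneg
    have h0 : f C₀ < u := hfS _ ⟨C₀, hC₀, by simpa using Matrix.PosSemidef.zero⟩
    -- `S` is stable under subtracting positive matrices; with this multiple of `P` subtracted from
    -- `C₀`, `f` would take the value `u`, which it never reaches on `S`.
    have ht : 0 ≤ (u - f C₀) / (-f P) := div_nonneg (by linarith) (by linarith)
    have h1 := hfS (C₀ - ((u - f C₀) / (-f P)) • P)
      ⟨C₀, hC₀, by simpa using posSemidef_real_smul hP ht⟩
    rw [map_sub, map_smul, smul_eq_mul, div_mul_eq_mul_div, mul_div_assoc, div_neg,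
      div_self hneg.ne] at h1
    linarith
  have hρ : (R + R.conjTranspose).PosSemidef := by
    have hherm : (R + R.conjTranspose).IsHermitian := Matrix.isHermitian_add_transpose_self R
    refine .of_dotProduct_mulVec_nonneg hherm fun x => ?_
    have hP := Matrix.posSemidef_vecMulVec_self_star x
    have heq : dotProduct (star x) ((R + R.conjTranspose).mulVec x) =
        ((R + R.conjTranspose) * Matrix.vecMulVec x (star x)).trace := by
      rw [Matrix.mul_vecMulVec, Matrix.trace_vecMulVec, dotProduct_comm]
    refine Complex.nonneg_iff.mpr ⟨?_, ?_⟩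
    · rw [heq, hR' _ hP.1]
      linarith [hfP _ hP]
    · exact (hherm.im_star_dotProduct_mulVec_self x).symm
  obtain ⟨C, hC, hle⟩ := h _ hρ (f H - u) (by linarith)
  rw [hR' _ hH, hR' _ (hKH _ hC)] at hle
  have := hfS C ⟨C, hC, by simpa using Matrix.PosSemidef.zero⟩
  linarith

/-- Jordan decomposition of a Hermitian matrix, with the spectral projection onto the negative
part. -/
theorem exists_jordan_decomposition [Fintype n] [DecidableEq n] {X : Matrix n n ℂ}
    (hX : X.IsHermitian) :
    ∃ P N Q : Matrix n n ℂ, P.PosSemidef ∧ N.PosSemidef ∧ Q.PosSemidef ∧ (1 - Q).PosSemidef ∧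
      X = P - N ∧ P.trace.re + N.trace.re = traceNorm X ∧ (Q * X).trace.re = -N.trace.re := by
  set U := hX.eigenvectorUnitary
  set D : (n → ℝ) → Matrix n n ℂ := fun d =>
    Unitary.conjStarAlgAut ℂ _ U (Matrix.diagonal fun i => (d i : ℂ)) with hD
  have hDpos : ∀ d : n → ℝ, (∀ i, 0 ≤ d i) → (D d).PosSemidef := fun d hd => by
    rw [hD]
    simp only [Unitary.conjStarAlgAut_apply, Matrix.star_eq_conjTranspose]
    exact Matrix.PosSemidef.mul_mul_conjTranspose_same
      (.diagonal fun i => by simpa using hd i) _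
  have hDtr : ∀ d : n → ℝ, (D d).trace.re = ∑ i, d i := fun d => by
    rw [hD]
    simp only [Unitary.conjStarAlgAut_apply]
    rw [Matrix.trace_mul_cycle, Unitary.coe_star_mul_self, one_mul, Matrix.trace_diagonal]
    simp
  have hDmul : ∀ d e : n → ℝ, D d * D e = D (d * e) := fun d e => by
    simp only [hD]
    rw [← map_mul, Matrix.diagonal_mul_diagonal]
    simp
  have hDsub : ∀ d e : n → ℝ, D d - D e = D (d - e) := fun d e => by
    simp only [hD]
    rw [← map_sub, Matrix.diagonal_sub]
    simp
  have hDone : (1 : Matrix n n ℂ) = D 1 := by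
    simp [hD]
  have hXD : X = D hX.eigenvalues := hX.spectral_theorem
  -- `traceNorm` uses the eigenvalues of `Xᴴ X` in their own enumeration, so they are matched with
  -- the squares of those of `X` as multisets of roots of the characteristic polynomial.
  have hnorm : traceNorm X = ∑ i, |hX.eigenvalues i| := by
    have hsq : X.conjTranspose * X = D (fun i => hX.eigenvalues i ^ 2) := by
      conv_lhs => rw [hX.eq, hXD, hDmul]
      congr 1
      ext i
      simp [sq]
    have hroots := (Matrix.isHermitian_conjTranspose_mul_self X).roots_charpoly_eq_eigenvalues
    have hchar : (X.conjTranspose * X).charpoly =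
        ∏ i, (Polynomial.X - Polynomial.C ((hX.eigenvalues i ^ 2 : ℝ) : ℂ)) := by
      rw [hsq, hD]
      simp only [Unitary.conjStarAlgAut_apply]
      rw [Matrix.charpoly_mul_comm, ← mul_assoc, Unitary.coe_star_mul_self, one_mul,
        Matrix.charpoly_diagonal]
    rw [hchar, Polynomial.roots_prod _ _ (by
      exact Finset.prod_ne_zero_iff.mpr fun i _ => Polynomial.X_sub_C_ne_zero _)] at hroots
    have h2 := congrArg (fun s => (s.map fun z : ℂ => Real.sqrt z.re).sum) hroots
    simp only [Polynomial.roots_X_sub_C, Multiset.bind_singleton, Multiset.map_map] at h2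
    have h3 : (∑ i, Real.sqrt (hX.eigenvalues i ^ 2)) = traceNorm X := by
      simpa only [traceNorm, Finset.sum, Function.comp_def, Complex.ofReal_re,
        RCLike.ofReal_eq_complex_ofReal] using h2
    rw [← h3]
    simp [Real.sqrt_sq_eq_abs]
  refine ⟨D fun i => max (hX.eigenvalues i) 0, D fun i => max (-hX.eigenvalues i) 0,
    D fun i => if hX.eigenvalues i < 0 then 1 else 0, hDpos _ fun i => le_max_right _ _,
    hDpos _ fun i => le_max_right _ _, hDpos _ fun i => by split_ifs <;> simp, ?_, ?_, ?_, ?_⟩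
  · rw [hDone, hDsub]
    refine hDpos _ fun i => ?_
    simp only [Pi.sub_apply, Pi.one_apply]
    split_ifs <;> simp
  · rw [hDsub]
    conv_lhs => rw [hXD]
    congr 1
    ext i
    simp only [Pi.sub_apply]
    rcases le_total 0 (hX.eigenvalues i) with h | h
    · rw [max_eq_left h, max_eq_right (by linarith)]; ring
    · rw [max_eq_right h, max_eq_left (by linarith)]; ring
  · rw [hnorm, hDtr, hDtr, ← Finset.sum_add_distrib]
    refine Finset.sum_congr rfl fun i _ => ?_
    rcases le_total 0 (hX.eigenvalues i) with h | h
    · rw [max_eq_left h, max_eq_right (by linarith), abs_of_nonneg h]; ring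
    · rw [max_eq_right h, max_eq_left (by linarith), abs_of_nonpos h]; ring
  · have : ((D fun i => if hX.eigenvalues i < 0 then 1 else 0) * X).trace.re =
        ∑ i, (if hX.eigenvalues i < 0 then 1 else 0) * hX.eigenvalues i := by
      have h := hDmul (fun i => if hX.eigenvalues i < 0 then 1 else 0) hX.eigenvalues
      rw [← hXD] at h
      rw [h, hDtr]
      rfl
    rw [this, hDtr, ← Finset.sum_neg_distrib]
    refine Finset.sum_congr rfl fun i _ => ?_
    split_ifs with h
    · rw [max_eq_left (by linarith)]; ring
    · rw [max_eq_right (by linarith)]; ring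

end PositiveSemidefinite

/-! ### Choi operators, complete positivity and channels. -/

section Choi

variable {a : Type u} {b : Type v} {r : Type w}

/-- The Choi correspondence `C (i, k) (j, l) = φ(|i⟩⟨j|) k l`. -/
def choi [Fintype a] [DecidableEq a] : MatMap a b ≃ₗ[ℂ] Matrix (a × b) (a × b) ℂ where
  toFun φ := Matrix.of fun p q => φ (Matrix.single p.1 q.1 1) p.2 q.2
  map_add' φ ψ := by ext; simp
  map_smul' c φ := by ext; simp
  invFun C :=
    { toFun X := Matrix.of fun k l => ∑ i, ∑ j, X i j * C (i, k) (j, l)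
      map_add' X Y := by ext; simp [add_mul, Finset.sum_add_distrib]
      map_smul' c X := by ext; simp [mul_assoc, Finset.mul_sum] }
  left_inv φ := by
    refine LinearMap.ext fun X => ?_
    conv_rhs => rw [Matrix.matrix_eq_sum_single X]
    ext k l
    simp only [map_sum, Matrix.sum_apply, LinearMap.coe_mk, AddHom.coe_mk, Matrix.of_apply]
    refine Finset.sum_congr rfl fun i _ => Finset.sum_congr rfl fun j _ => ?_
    rw [← mul_one (X i j), ← smul_eq_mul (X i j), ← Matrix.smul_single, map_smul]
    simp
  right_inv C := by
    ext ⟨i, k⟩ ⟨j, l⟩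
    simp [Matrix.single_apply, ite_and]

variable [Fintype a] [DecidableEq a]

theorem choi_apply (φ : MatMap a b) (p q : a × b) :
    choi φ p q = φ (Matrix.single p.1 q.1 1) p.2 q.2 := rfl

theorem map_apply_eq_sum_choi (φ : MatMap a b) (X : Matrix a a ℂ) (k l : b) :
    φ X k l = ∑ i, ∑ j, X i j * choi φ (i, k) (j, l) := by
  conv_lhs => rw [← choi.symm_apply_apply φ]
  rfl

theorem tensorId_apply (φ : MatMap a b) (X : Matrix (a × r) (a × r) ℂ) (p q : b × r) :
    tensorId φ X p q = ∑ i, ∑ j, X (i, p.2) (j, q.2) * choi φ (i, p.1) (j, q.1) := by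
  simp [tensorId, map_apply_eq_sum_choi φ]

/-- The output is a block sum of a principal submatrix of `X ⊗ choi φ`, the one where both
`a`-indices agree. -/
theorem tensorId_posSemidef_of_choi [Fintype b] [Fintype r] {φ : MatMap a b}
    (hφ : (choi φ).PosSemidef) {X : Matrix (a × r) (a × r) ℂ} (hX : X.PosSemidef) :
    (tensorId φ X).PosSemidef := by
  have h := posSemidef_sum_blocks ((hX.kronecker hφ).submatrix
    (fun p : a × (b × r) => ((p.1, p.2.2), (p.1, p.2.1))))
  convert h using 1
  ext p q
  rw [tensorId_apply]
  rfl

/-- Choi's theorem. For the forward direction, `choi φ` is, up to relabelling, the image of the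
unnormalized maximally entangled operator with ancilla of dimension `card a`. -/
theorem isCP_iff [Fintype b] {φ : MatMap a b} : IsCP φ ↔ (choi φ).PosSemidef := by
  refine ⟨fun h => ?_, fun h n X hX => tensorId_posSemidef_of_choi h hX⟩
  let e := Fintype.equivFin a
  let v : a × Fin (Fintype.card a) → ℂ := fun p => if p.1 = e.symm p.2 then 1 else 0
  have := (h _ _ (Matrix.posSemidef_vecMulVec_self_star v)).submatrix
    (fun p : a × b => (p.2, e p.1))
  convert this using 1
  ext p q
  simp [tensorId_apply, Matrix.vecMulVec_apply, v]

theorem IsCP.tensorId_posSemidef [Fintype b] [Fintype r] {φ : MatMap a b} (hφ : IsCP φ)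
    {X : Matrix (a × r) (a × r) ℂ} (hX : X.PosSemidef) : (tensorId φ X).PosSemidef :=
  tensorId_posSemidef_of_choi (isCP_iff.mp hφ) hX

omit [Fintype a] [DecidableEq a] in
theorem IsCP.comp {c : Type*} {ψ : MatMap b c} {φ : MatMap a b} (hψ : IsCP ψ) (hφ : IsCP φ) :
    IsCP (ψ ∘ₗ φ) := fun n X hX => hψ n _ (hφ n X hX)

omit [DecidableEq a] in
theorem IsChannel.comp [Fintype b] {c : Type*} [Fintype c] {ψ : MatMap b c} {φ : MatMap a b}
    (hψ : IsChannel ψ) (hφ : IsChannel φ) : IsChannel (ψ ∘ₗ φ) :=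
  ⟨hψ.1.comp hφ.1, fun X => (hψ.2 _).trans (hφ.2 X)⟩

theorem IsCP.add [Fintype b] {φ ψ : MatMap a b} (hφ : IsCP φ) (hψ : IsCP ψ) : IsCP (φ + ψ) := by
  rw [isCP_iff, map_add]
  exact (isCP_iff.mp hφ).add (isCP_iff.mp hψ)

theorem IsCP.smul [Fintype b] {φ : MatMap a b} (hφ : IsCP φ) {c : ℂ} (hc : 0 ≤ c) :
    IsCP (c • φ) := by
  rw [isCP_iff, map_smul]
  exact (isCP_iff.mp hφ).smul hc

/-- The partial trace over the second factor. -/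
def ptrace [Fintype b] : Matrix (a × b) (a × b) ℂ →ₗ[ℂ] Matrix a a ℂ where
  toFun C := Matrix.of fun i j => ∑ k, C (i, k) (j, k)
  map_add' X Y := by ext; simp [Finset.sum_add_distrib]
  map_smul' c X := by ext; simp [Finset.mul_sum]

omit [Fintype a] [DecidableEq a] in
theorem ptrace_apply [Fintype b] (C : Matrix (a × b) (a × b) ℂ) (i j : a) :
    ptrace C i j = ∑ k, C (i, k) (j, k) := rfl

omit [DecidableEq a] in
theorem trace_ptrace [Fintype b] (C : Matrix (a × b) (a × b) ℂ) : (ptrace C).trace = C.trace := by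
  simp [Matrix.trace, ptrace_apply, Fintype.sum_prod_type]

omit [Fintype a] [DecidableEq a] in
theorem ptrace_posSemidef [Fintype b] {C : Matrix (a × b) (a × b) ℂ} (hC : C.PosSemidef) :
    (ptrace C).PosSemidef := by
  have : ptrace C = ∑ k, C.submatrix (fun i => (i, k)) (fun i => (i, k)) := by
    ext i j
    simp [ptrace_apply, Matrix.sum_apply]
  rw [this]
  exact Matrix.posSemidef_sum _ fun k _ => hC.submatrix _

theorem trace_map_eq [Fintype b] (φ : MatMap a b) (X : Matrix a a ℂ) :
    (φ X).trace = ∑ i, ∑ j, X i j * ptrace (choi φ) i j := by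
  simp only [Matrix.trace, Matrix.diag_apply, map_apply_eq_sum_choi φ, ptrace_apply,
    Finset.mul_sum]
  rw [Finset.sum_comm]
  exact Finset.sum_congr rfl fun i _ => Finset.sum_comm

theorem trace_map_eq_mul_iff [Fintype b] {φ : MatMap a b} {c : ℂ} :
    (∀ X, (φ X).trace = c * X.trace) ↔ ptrace (choi φ) = c • 1 := by
  constructor
  · intro h
    ext i j
    have := h (Matrix.single i j 1)
    rw [trace_map_eq] at this
    simpa [Matrix.single_apply, ite_and, Matrix.trace, Matrix.one_apply, eq_comm (a := j)] using this
  · intro h X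
    rw [trace_map_eq, h]
    simp [Matrix.one_apply, Matrix.trace, Finset.mul_sum, mul_comm]

theorem isChannel_iff [Fintype b] {φ : MatMap a b} :
    IsChannel φ ↔ (choi φ).PosSemidef ∧ ptrace (choi φ) = 1 := by
  have := trace_map_eq_mul_iff (φ := φ) (c := 1)
  simp only [one_mul, one_smul] at this
  rw [IsChannel, isCP_iff, this]

theorem IsChannel.isHermitian_choi [Fintype b] {φ : MatMap a b} (hφ : IsChannel φ) :
    (choi φ).IsHermitian := (isChannel_iff.mp hφ).1.1

theorem isCompact_choi [Fintype b] (c : ℝ) :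
    IsCompact {C : Matrix (a × b) (a × b) ℂ | C.PosSemidef ∧ ptrace C = (c : ℂ) • 1} := by
  refine (isCompact_posSemidef_trace_le (c * Fintype.card a)).of_isClosed_subset ?_ ?_
  · exact isClosed_posSemidef.inter
      (isClosed_eq ptrace.continuous_of_finiteDimensional continuous_const)
  · rintro C ⟨hC, hc⟩
    refine ⟨hC, le_of_eq ?_⟩
    rw [← trace_ptrace, hc]
    simp

theorem exists_isChannel [Fintype b] [Nonempty b] : ∃ φ : MatMap a b, IsChannel φ := by
  classical
  refine ⟨choi.symm ((Fintype.card b : ℂ)⁻¹ • 1), ?_⟩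
  rw [isChannel_iff, choi.apply_symm_apply]
  refine ⟨Matrix.PosSemidef.one.smul (by positivity), ?_⟩
  ext i j
  simp [ptrace_apply, Matrix.one_apply]

theorem IsCP.exists_channel_smul [Fintype b] [Nonempty b] {Q : MatMap a b} (hQ : IsCP Q) {c : ℝ}
    (hc : 0 ≤ c) (h : ∀ X, (Q X).trace = c * X.trace) : ∃ β, IsChannel β ∧ Q = (c : ℂ) • β := by
  -- For `c = 0` the Choi operator is positive with trace zero, so `Q = 0` and any channel serves as
  -- `β`.
  rcases hc.eq_or_lt with rfl | hc
  · obtain ⟨β, hβ⟩ := exists_isChannel (a := a) (b := b)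
    refine ⟨β, hβ, ?_⟩
    have h0 : choi Q = 0 := by
      rw [← (isCP_iff.mp hQ).trace_eq_zero_iff, ← trace_ptrace, trace_map_eq_mul_iff.mp h]
      simp
    simpa using h0
  · have hc' : (c : ℂ) ≠ 0 := by exact_mod_cast hc.ne'
    refine ⟨(c : ℂ)⁻¹ • Q, ⟨hQ.smul ?_, fun X => ?_⟩, ?_⟩
    · rw [← Complex.ofReal_inv]
      exact_mod_cast (inv_nonneg.mpr hc.le)
    · rw [LinearMap.smul_apply, Matrix.trace_smul, h, smul_eq_mul, inv_mul_cancel_left₀ hc']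
    · rw [smul_inv_smul₀ hc']

/-- Channels form a compact set, so the suprema below are genuine and not the default value of
`sSup`. -/
theorem bddAbove_channels [Fintype b] (F : MatMap a b →ₗ[ℂ] ℂ) :
    BddAbove {t : ℝ | ∃ α, IsChannel α ∧ t = (F α).re} := by
  have hcont : Continuous fun C : Matrix (a × b) (a × b) ℂ => (F (choi.symm C)).re :=
    Complex.continuous_re.comp (F ∘ₗ choi.symm.toLinearMap).continuous_of_finiteDimensional
  refine ((isCompact_choi (a := a) (b := b) 1).image hcont).bddAbove.mono ?_
  rintro t ⟨α, hα, rfl⟩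
  exact ⟨choi α, by simpa using isChannel_iff.mp hα, by simp⟩

end Choi

/-! ### The pairing and the dual norm. -/

section Pairing

variable {a : Type u} {b : Type v} [Fintype a] [DecidableEq a] [Fintype b]

/-- The pairing with a fixed operator, as a linear functional. -/
def pairingLin (X : Matrix (a × b) (a × b) ℂ) : MatMap a b →ₗ[ℂ] ℂ where
  toFun φ := pairing X φ
  map_add' φ ψ := by simp [pairing, tensorId, Finset.sum_add_distrib]
  map_smul' c φ := by simp [pairing, tensorId, Finset.mul_sum]

omit [Fintype a] [DecidableEq a] in
theorem pairingLin_apply (X : Matrix (a × b) (a × b) ℂ) (φ : MatMap a b) :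
    pairingLin X φ = pairing X φ := rfl

theorem pairing_eq_trace (X : Matrix (a × b) (a × b) ℂ) (φ : MatMap a b) :
    pairing X φ = (X * (choi φ).transpose).trace := by
  simp only [pairing, tensorId_apply, Matrix.trace, Matrix.diag_apply, Matrix.mul_apply,
    Matrix.transpose_apply, Fintype.sum_prod_type]
  rw [Finset.sum_comm (s := (Finset.univ : Finset a))]
  refine Finset.sum_congr rfl fun k _ => ?_
  rw [Finset.sum_comm]
  exact Finset.sum_congr rfl fun i _ => Finset.sum_comm

theorem re_pairing_nonneg {X : Matrix (a × b) (a × b) ℂ} (hX : X.PosSemidef) {φ : MatMap a b}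
    (hφ : IsCP φ) : 0 ≤ (pairing X φ).re := by
  rw [pairing_eq_trace]
  exact re_trace_mul_nonneg hX (isCP_iff.mp hφ).transpose

/-- Monotonicity of the pairing replaces `φ` by its bound `β`, and `φ = β` is itself admissible.
Assuming positivity of the pairing rather than of `X` lets the lemma apply to `idTensor
(transposeMap Φ) ρ` without proving that operator positive. -/
theorem dualNorm_eq_sSup [Nonempty b] {X : Matrix (a × b) (a × b) ℂ}
    (hX : ∀ φ : MatMap a b, IsCP φ → 0 ≤ (pairing X φ).re) :
    dualNorm X = sSup {t : ℝ | ∃ β, IsChannel β ∧ t = (pairing X β).re} := by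
  have hbdd := bddAbove_channels (pairingLin X)
  have hsub : ∀ φ β : MatMap a b, (pairing X (β - φ)).re = (pairing X β).re - (pairing X φ).re :=
    fun φ β => by
      rw [← Complex.sub_re, ← pairingLin_apply, map_sub]; rfl
  have hle : ∀ t ∈ {t : ℝ | ∃ φ β : MatMap a b, IsChannel β ∧ IsCP (β - φ) ∧ IsCP (β + φ) ∧
      t = (pairing X φ).re}, t ≤ sSup {t : ℝ | ∃ β, IsChannel β ∧ t = (pairing X β).re} := by
    rintro t ⟨φ, β, hβ, h₁, -, rfl⟩
    have := hX _ h₁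
    rw [hsub] at this
    exact (by linarith : (pairing X φ).re ≤ (pairing X β).re).trans (le_csSup hbdd ⟨β, hβ, rfl⟩)
  have hmem : ∀ β : MatMap a b, IsChannel β → (pairing X β).re ∈
      {t : ℝ | ∃ φ β : MatMap a b, IsChannel β ∧ IsCP (β - φ) ∧ IsCP (β + φ) ∧
        t = (pairing X φ).re} := fun β hβ => by
    refine ⟨β, β, hβ, ?_, hβ.1.add hβ.1, rfl⟩
    rw [sub_self, isCP_iff, map_zero]
    exact .zero
  obtain ⟨β, hβ⟩ := exists_isChannel (a := a) (b := b)
  refine le_antisymm (csSup_le ⟨_, hmem β hβ⟩ hle) (csSup_le ⟨_, β, hβ, rfl⟩ ?_)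
  rintro t ⟨β, hβ, rfl⟩
  exact le_csSup ⟨_, hle⟩ (hmem β hβ)

theorem dualNorm_posSemidef_eq [Nonempty b] {X : Matrix (a × b) (a × b) ℂ} (hX : X.PosSemidef) :
    dualNorm X = sSup {t : ℝ | ∃ β, IsChannel β ∧ t = (pairing X β).re} :=
  dualNorm_eq_sSup fun _ hφ => re_pairing_nonneg hX hφ

theorem re_pairing_le_dualNorm [Nonempty b] {X : Matrix (a × b) (a × b) ℂ} (hX : X.PosSemidef)
    {β : MatMap a b} (hβ : IsChannel β) : (pairing X β).re ≤ dualNorm X := by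
  rw [dualNorm_posSemidef_eq hX]
  exact le_csSup (bddAbove_channels (pairingLin X)) ⟨β, hβ, rfl⟩

-- This is why the transposed map occurs in (ii): it moves across the pairing to become
-- postcomposition with `Φ`.
omit [Fintype a] [DecidableEq a] in
theorem pairing_idTensor_transposeMap [DecidableEq b] {c : Type*} [Fintype c]
    (Φ : MatMap b c) (X : Matrix (a × c) (a × c) ℂ) (φ : MatMap a b) :
    pairing (idTensor (transposeMap Φ) X) φ = pairing X (Φ ∘ₗ φ) := by
  have hblock : ∀ i j : b, (Matrix.of fun p q => idTensor (transposeMap Φ) X (p, i) (q, j)) =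
      ∑ s, ∑ t, choi Φ (i, s) (j, t) • Matrix.of fun p q => X (p, s) (q, t) := by
    intro i j
    ext p q
    simp [idTensor, transposeMap, traceAdjoint, Matrix.trace, Matrix.mul_apply, Matrix.sum_apply,
      choi_apply]
  simp only [pairing, tensorId, Matrix.of_apply, hblock, LinearMap.comp_apply,
    map_apply_eq_sum_choi Φ, map_sum, map_smul, Matrix.sum_apply, Matrix.smul_apply, smul_eq_mul]
  simp only [← Finset.sum_product', Finset.univ_product_univ]
  exact Fintype.sum_equiv
    ⟨fun x => (x.2.2.1, x.2.2.2, x.1, x.2.1), fun x => (x.2.2.1, x.2.2.2, x.1, x.2.1),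
      fun _ => rfl, fun _ => rfl⟩ _ _ fun x => mul_comm _ _

theorem dualNorm_idTensor_eq [DecidableEq b] [Nonempty b] {c : Type*} [Fintype c]
    {Φ : MatMap b c} (hΦ : IsCP Φ) {X : Matrix (a × c) (a × c) ℂ} (hX : X.PosSemidef) :
    dualNorm (idTensor (transposeMap Φ) X) =
      sSup {t : ℝ | ∃ β : MatMap a b, IsChannel β ∧ t = (pairing X (Φ ∘ₗ β)).re} := by
  simp only [← pairing_idTensor_transposeMap]
  refine dualNorm_eq_sSup fun φ hφ => ?_
  rw [pairing_idTensor_transposeMap]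
  exact re_pairing_nonneg hX (hΦ.comp hφ)

theorem re_pairing_comp_le_dualNorm [DecidableEq b] [Nonempty b] {c : Type*} [Fintype c]
    {Φ : MatMap b c} (hΦ : IsCP Φ) {X : Matrix (a × c) (a × c) ℂ} (hX : X.PosSemidef)
    {β : MatMap a b} (hβ : IsChannel β) :
    (pairing X (Φ ∘ₗ β)).re ≤ dualNorm (idTensor (transposeMap Φ) X) := by
  rw [dualNorm_idTensor_eq hΦ hX]
  simp only [← pairing_idTensor_transposeMap]
  exact le_csSup (bddAbove_channels (pairingLin (idTensor (transposeMap Φ) X))) ⟨β, hβ, rfl⟩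

end Pairing

/-! ### Adjoint maps and pulled-back measurements. -/

section Adjoint

variable {a : Type u} {b : Type v} {r : Type w} [Fintype a] [DecidableEq a] [Fintype b] [Fintype r]

omit [DecidableEq a] in
theorem trace_mul_eq_sum_blocks (X Y : Matrix (a × r) (a × r) ℂ) :
    (X * Y).trace = ∑ s, ∑ t, ((Matrix.of fun i j => X (i, s) (j, t)) *
      (Matrix.of fun i j => Y (i, t) (j, s)) : Matrix a a ℂ).trace := by
  simp only [Matrix.trace, Matrix.diag_apply, Matrix.mul_apply, Matrix.of_apply,
    Fintype.sum_prod_type]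
  rw [Finset.sum_comm]
  refine Finset.sum_congr rfl fun s _ => ?_
  rw [Finset.sum_comm]
  simp only [Finset.sum_comm (s := (Finset.univ : Finset r))]
  exact Finset.sum_comm

theorem trace_tensorId_mul (Φ : MatMap a b) (X : Matrix (a × r) (a × r) ℂ)
    (Y : Matrix (b × r) (b × r) ℂ) :
    (X * tensorId (traceAdjoint Φ) Y).trace = (tensorId Φ X * Y).trace := by
  rw [trace_mul_eq_sum_blocks, trace_mul_eq_sum_blocks]
  have hblock : ∀ s t, (Matrix.of fun i j => tensorId Φ X (i, s) (j, t)) =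
      Φ (Matrix.of fun i j => X (i, s) (j, t)) := fun _ _ => rfl
  have hblock' : ∀ s t, (Matrix.of fun i j => tensorId (traceAdjoint Φ) Y (i, s) (j, t)) =
      traceAdjoint Φ (Matrix.of fun i j => Y (i, s) (j, t)) := fun _ _ => rfl
  simp only [hblock, hblock', trace_mul_traceAdjoint]

theorem choi_traceAdjoint [DecidableEq b] (Φ : MatMap a b) (p q : b × a) :
    choi (traceAdjoint Φ) p q = choi Φ (q.2, q.1) (p.2, p.1) := by
  simp [choi_apply, traceAdjoint, Matrix.trace_mul_single]

theorem IsCP.traceAdjoint {Φ : MatMap a b} (hΦ : IsCP Φ) : IsCP (traceAdjoint Φ) := by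
  classical
  rw [isCP_iff] at hΦ ⊢
  have h : choi (QChan.traceAdjoint Φ) =
      (choi Φ).transpose.submatrix (fun p : b × a => (p.2, p.1)) fun p => (p.2, p.1) :=
    Matrix.ext fun p q => choi_traceAdjoint Φ p q
  rw [h]
  exact hΦ.transpose.submatrix _

theorem traceAdjoint_one [DecidableEq b] {Φ : MatMap a b} (hΦ : IsChannel Φ) :
    traceAdjoint Φ 1 = 1 := by
  ext i j
  rw [show traceAdjoint Φ 1 i j = (Φ (Matrix.single j i 1) * 1).trace from rfl, mul_one, hΦ.2]
  simp [Matrix.one_apply, Matrix.trace, Matrix.single_apply, ite_and, eq_comm (a := i)]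

omit [Fintype r] in
theorem tensorId_traceAdjoint_one [DecidableEq b] [DecidableEq r] {Φ : MatMap a b}
    (hΦ : IsChannel Φ) :
    tensorId (traceAdjoint Φ) (1 : Matrix (b × r) (b × r) ℂ) = 1 := by
  ext ⟨i, s⟩ ⟨j, t⟩
  have h : (Matrix.of fun i j => (1 : Matrix (b × r) (b × r) ℂ) (i, s) (j, t)) =
      (1 : Matrix r r ℂ) s t • (1 : Matrix b b ℂ) := by
    ext i j
    simp [Matrix.one_apply, ite_and]
  simp only [tensorId, Matrix.of_apply, h, map_smul, traceAdjoint_one hΦ]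
  simp [Matrix.one_apply, ite_and]

theorem IsMeasurement.tensorId_traceAdjoint [DecidableEq b] [DecidableEq r] {Φ : MatMap a b}
    (hΦ : IsChannel Φ) {k : ℕ} {M : Fin k → Matrix (b × r) (b × r) ℂ} (hM : IsMeasurement M) :
    IsMeasurement fun i => tensorId (QChan.traceAdjoint Φ) (M i) := by
  refine ⟨fun i => hΦ.1.traceAdjoint.tensorId_posSemidef (hM.1 i), ?_⟩
  rw [← tensorId_traceAdjoint_one hΦ, ← hM.2]
  ext p q
  simp only [tensorId_apply, Matrix.sum_apply, Finset.sum_mul]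
  rw [Finset.sum_comm]
  exact Finset.sum_congr rfl fun i _ => Finset.sum_comm

/-- Passing from the Heisenberg to the Schrödinger picture: `Φ` acts on the states instead of on the
measurement. -/
theorem succProb_tensorId {c : Type*} [Fintype c] [DecidableEq b]
    (Φ : MatMap a b) (φ : MatMap c a) {k : ℕ} (lam : Fin k → ℝ)
    (ρ : Fin k → Matrix (c × r) (c × r) ℂ) (M : Fin k → Matrix (b × r) (b × r) ℂ) :
    succProb lam (fun i => tensorId φ (ρ i)) (fun i => tensorId (QChan.traceAdjoint Φ) (M i)) =
      succProb lam (fun i => tensorId (Φ ∘ₗ φ) (ρ i)) M := by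
  simp only [succProb, trace_tensorId_mul]
  rfl

end Adjoint

/-! ### Semidefinite duality for the diamond norm. -/

section Diamond

variable {a : Type u} {b : Type v} {r : Type w} [Fintype a] [DecidableEq a] [Fintype b] [Fintype r]

omit [Fintype b] [Fintype r] in
theorem tensorId_isHermitian {φ : MatMap a b} (hφ : (choi φ).IsHermitian)
    {X : Matrix (a × r) (a × r) ℂ} (hX : X.IsHermitian) : (tensorId φ X).IsHermitian := by
  ext p q
  simp only [Matrix.conjTranspose_apply, tensorId_apply, star_sum, star_mul', hX.apply, hφ.apply]
  exact Finset.sum_comm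

omit [DecidableEq a] in
theorem trace_tensorId {φ : MatMap a b} {c : ℂ} (h : ∀ X, (φ X).trace = c * X.trace)
    (X : Matrix (a × r) (a × r) ℂ) : (tensorId φ X).trace = c * X.trace := by
  have h' : ∀ s, ∑ k, φ (Matrix.of fun i j => X (i, s) (j, s)) k k = c * ∑ i, X (i, s) (i, s) :=
    fun s => h (Matrix.of fun i j => X (i, s) (j, s))
  simp only [Matrix.trace, Matrix.diag_apply, Fintype.sum_prod_type_right, tensorId,
    Matrix.of_apply, h', Finset.mul_sum]

omit [Fintype a] [DecidableEq a] [Fintype b] [Fintype r] in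
theorem tensorId_add (φ ψ : MatMap a b) (X : Matrix (a × r) (a × r) ℂ) :
    tensorId (φ + ψ) X = tensorId φ X + tensorId ψ X := rfl

omit [Fintype a] [DecidableEq a] [Fintype b] [Fintype r] in
theorem tensorId_smul (φ : MatMap a b) (c : ℂ) (X : Matrix (a × r) (a × r) ℂ) :
    tensorId φ (c • X) = c • tensorId φ X := by
  ext p q
  change φ (c • Matrix.of fun i j => X (i, p.2) (j, q.2)) p.1 q.1 = _
  rw [map_smul]
  rfl

/-- Upper bound on output trace norms from domination by a multiple of a channel. -/
theorem traceNorm_tensorId_le [DecidableEq b] [DecidableEq r] {ψ Q : MatMap a b} {c : ℝ}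
    (hψ : (choi ψ).IsHermitian) (hψ0 : ∀ X, (ψ X).trace = 0) (hQ : IsCP Q)
    (hQc : ∀ X, (Q X).trace = c * X.trace) (hQψ : IsCP (Q + ψ))
    {ρ : Matrix (a × r) (a × r) ℂ} (hρ : IsState ρ) : traceNorm (tensorId ψ ρ) ≤ 2 * c := by
  obtain ⟨P, N, E, hP, hN, hE, hE', hX, hnorm, hEX⟩ :=
    exists_jordan_decomposition (tensorId_isHermitian hψ hρ.1.1)
  have h0 : P.trace.re - N.trace.re = 0 := by
    rw [← Complex.sub_re, ← Matrix.trace_sub, ← hX,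
      trace_tensorId (c := 0) (fun X => by rw [hψ0, zero_mul]), zero_mul, Complex.zero_re]
  -- With `E` the projection onto the negative part of `ψ(ρ)`, `Tr N = -Tr[E ψ(ρ)] ≤ Tr[E Q(ρ)] ≤ Tr
  -- Q(ρ) = c`. As `ψ(ρ)` is traceless, its trace norm is `2 Tr N`.
  have h1 := re_trace_mul_nonneg hE (hQψ.tensorId_posSemidef hρ.1)
  have h2 := re_trace_mul_nonneg hE' (hQ.tensorId_posSemidef hρ.1)
  rw [tensorId_add, Matrix.mul_add, Matrix.trace_add, Complex.add_re] at h1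
  rw [Matrix.sub_mul, one_mul, Matrix.trace_sub, Complex.sub_re, trace_tensorId hQc, hρ.2,
    mul_one, Complex.ofReal_re] at h2
  linarith

omit [DecidableEq a] in
theorem trace_mul_ptrace [DecidableEq b] (σ : Matrix a a ℂ) (J : Matrix (a × b) (a × b) ℂ) :
    (σ * ptrace J).trace = (Matrix.kroneckerMap (· * ·) σ (1 : Matrix b b ℂ) * J).trace := by
  simp only [Matrix.trace, Matrix.diag_apply, Matrix.mul_apply, ptrace_apply,
    Fintype.sum_prod_type, Matrix.kroneckerMap_apply, Matrix.one_apply, mul_ite, mul_one, mul_zero,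
    ite_mul, zero_mul, Finset.sum_ite_eq, Finset.mem_univ, if_true, Finset.mul_sum]
  exact Finset.sum_congr rfl fun i _ => Finset.sum_comm

/-- Write `σ = sᴴ s` and feed `ψ` the pure state with coefficient matrix `s`, normalized. The output
is, up to scale and a swap, `choi ψ` conjugated by `s ⊗ 1`. Its negative part has trace at most `c`,
being half the trace norm; conjugating it back by `s⁻¹ ⊗ 1` gives `J`, whose trace weighted by `σ`
is the trace before conjugation. -/
theorem exists_small_weighted_trace [DecidableEq b] {ψ : MatMap a b} {c : ℝ}
    (hψ : (choi ψ).IsHermitian) (hψ0 : ∀ X, (ψ X).trace = 0)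
    (h : ∀ ρ : Matrix (a × a) (a × a) ℂ, IsState ρ → traceNorm (tensorId ψ ρ) ≤ 2 * c)
    {σ : Matrix a a ℂ} (hσ : σ.PosDef) (hσ0 : 0 < σ.trace.re) :
    ∃ J : Matrix (a × b) (a × b) ℂ, J.PosSemidef ∧ (J + choi ψ).PosSemidef ∧
      (σ * ptrace J).trace.re ≤ c * σ.trace.re := by
  obtain ⟨s, hs⟩ : ∃ s : Matrix a a ℂ, σ = s.conjTranspose * s := by
    open scoped MatrixOrder in
    exact CStarAlgebra.nonneg_iff_eq_star_mul_self.mp hσ.posSemidef.nonneg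
  have hsu : IsUnit s.det := by
    have := (Matrix.isUnit_iff_isUnit_det _).mp hσ.isUnit
    rw [hs, Matrix.det_mul] at this
    exact isUnit_of_mul_isUnit_right this
  set T : Matrix (a × b) (a × b) ℂ := Matrix.kroneckerMap (· * ·) s 1 with hT
  set S : Matrix (a × b) (a × b) ℂ := Matrix.kroneckerMap (· * ·) s⁻¹ 1 with hS
  have hTS : T * S = 1 := by
    rw [hT, hS, ← Matrix.mul_kronecker_mul, Matrix.mul_nonsing_inv _ hsu, one_mul,
      Matrix.one_kronecker_one]
  have hST : S * T = 1 := mul_eq_one_comm.mp hTS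
  set X : Matrix (a × a) (a × a) ℂ :=
    Matrix.vecMulVec (fun p => s p.2 p.1) (star fun p => s p.2 p.1) with hX
  have hXpos : X.PosSemidef := Matrix.posSemidef_vecMulVec_self_star _
  have hXtr : X.trace = σ.trace := by
    rw [hX, hs, Matrix.trace_vecMulVec]
    simp [dotProduct, Matrix.trace, Matrix.mul_apply, Fintype.sum_prod_type, mul_comm]
  have hτ : σ.trace = (σ.trace.re : ℂ) := trace_eq_re hσ.posSemidef
  set τ := σ.trace.re with hτd
  have hτ' : (τ : ℂ) ≠ 0 := by exact_mod_cast hσ0.ne'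
  have hρ : IsState ((τ : ℂ)⁻¹ • X) := by
    refine ⟨hXpos.smul ?_, ?_⟩
    · rw [← Complex.ofReal_inv]
      exact_mod_cast (inv_nonneg.mpr hσ0.le)
    · rw [Matrix.trace_smul, hXtr, hτ, smul_eq_mul, inv_mul_cancel₀ hτ']
  obtain ⟨P, N, -, hP, hN, -, -, hPN, hnorm, -⟩ :=
    exists_jordan_decomposition (tensorId_isHermitian hψ hρ.1.1)
  have h0 : P.trace.re - N.trace.re = 0 := by
    rw [← Complex.sub_re, ← Matrix.trace_sub, ← hPN,
      trace_tensorId (c := 0) (fun X => by rw [hψ0, zero_mul]), zero_mul, Complex.zero_re]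
  have hNc : N.trace.re ≤ c := by linarith [h _ hρ]
  have hXP : tensorId ψ X = τ • P - τ • N := by
    rw [← smul_sub, ← hPN, tensorId_smul]
    ext p q
    simp [hτ']
  have hconj : T * choi ψ * T.conjTranspose =
      (tensorId ψ X).submatrix Prod.swap Prod.swap := by
    ext ⟨i, k⟩ ⟨j, l⟩
    simp only [hT, Matrix.mul_apply, Matrix.kroneckerMap_apply, Matrix.one_apply,
      Fintype.sum_prod_type, Matrix.submatrix_apply, tensorId_apply, Matrix.conjTranspose_apply,
      Prod.swap_prod_mk, hX, Matrix.vecMulVec_apply, Pi.star_apply]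
    simp only [mul_ite, mul_one, mul_zero, ite_mul, zero_mul, Finset.sum_ite_eq, Finset.mem_univ,
      if_true, apply_ite star, star_zero, Finset.sum_mul]
    rw [Finset.sum_comm]
    exact Finset.sum_congr rfl fun i _ => Finset.sum_congr rfl fun j _ => by ring
  set N' : Matrix (a × b) (a × b) ℂ := (τ • N).submatrix Prod.swap Prod.swap with hN'
  have hN'pos : N'.PosSemidef := (posSemidef_real_smul hN hσ0.le).submatrix _
  have hN'add : (N' + T * choi ψ * T.conjTranspose).PosSemidef := by
    have : N' + T * choi ψ * T.conjTranspose = (τ • P).submatrix Prod.swap Prod.swap := by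
      rw [hconj, hXP, hN']
      ext p q
      simp
    rw [this]
    exact (posSemidef_real_smul hP hσ0.le).submatrix _
  have hTS' : T.conjTranspose * S.conjTranspose = 1 := by
    rw [← Matrix.conjTranspose_mul, hST, Matrix.conjTranspose_one]
  refine ⟨S * N' * S.conjTranspose, hN'pos.mul_mul_conjTranspose_same S, ?_, le_of_eq_of_le ?_
    (mul_le_mul_of_nonneg_right hNc hσ0.le)⟩
  · convert hN'add.mul_mul_conjTranspose_same S using 1
    rw [Matrix.mul_add, Matrix.add_mul]
    congr 1
    calc choi ψ = (S * T) * choi ψ * (T.conjTranspose * S.conjTranspose) := by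
          rw [hST, hTS', one_mul, mul_one]
      _ = _ := by simp only [mul_assoc]
  · have hσT : Matrix.kroneckerMap (· * ·) σ (1 : Matrix b b ℂ) = T.conjTranspose * T := by
      rw [hs, hT, Matrix.conjTranspose_kronecker, ← Matrix.mul_kronecker_mul,
        Matrix.conjTranspose_one, one_mul]
    rw [trace_mul_ptrace, hσT]
    have : T.conjTranspose * T * (S * N' * S.conjTranspose) =
        T.conjTranspose * (N' * S.conjTranspose) := by
      calc _ = T.conjTranspose * ((T * S) * (N' * S.conjTranspose)) := by simp only [mul_assoc]
        _ = _ := by rw [hTS, one_mul]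
    rw [this, Matrix.trace_mul_comm, mul_assoc]
    have hST' : S.conjTranspose * T.conjTranspose = 1 := by
      rw [← Matrix.conjTranspose_mul, hTS, Matrix.conjTranspose_one]
    rw [hST', mul_one, hN']
    have : ((τ • N).submatrix (Prod.swap : a × b → b × a) Prod.swap).trace = (τ • N).trace := by
      simp only [Matrix.trace, Matrix.diag_apply, Matrix.submatrix_apply]
      exact Fintype.sum_equiv (Equiv.prodComm a b) _ _ fun _ => rfl
    rw [this, Matrix.trace_smul]
    simp [mul_comm]

/-- A trace annihilating Hermitian map with output trace norms at most `2 c` is dominated by `c`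
times a channel. -/
theorem exists_isCP_dominating [Nonempty a] [DecidableEq b] [Nonempty b] {ψ : MatMap a b} {c : ℝ}
    (hc : 0 ≤ c) (hψ : (choi ψ).IsHermitian) (hψ0 : ∀ X, (ψ X).trace = 0)
    (h : ∀ ρ : Matrix (a × a) (a × a) ℂ, IsState ρ → traceNorm (tensorId ψ ρ) ≤ 2 * c) :
    ∃ Q : MatMap a b, IsCP Q ∧ (∀ X, (Q X).trace = c * X.trace) ∧ IsCP (Q + ψ) := by
  -- Finding `J` with `ptrace J ≤ c • 1` means dominating `-(c • 1)` from `K`. The minus sign turns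
  -- a lower bound on the trace in `K` into an upper bound on `Tr J`, hence compact slices.
  set K : Set (Matrix a a ℂ) := {H | ∃ J : Matrix (a × b) (a × b) ℂ,
    J.PosSemidef ∧ (J + choi ψ).PosSemidef ∧ H = -ptrace J} with hK
  have hKconv : Convex ℝ K := by
    rintro _ ⟨J, hJ, hJψ, rfl⟩ _ ⟨J', hJ', hJψ', rfl⟩ s t hs ht hst
    refine ⟨s • J + t • J', (posSemidef_real_smul hJ hs).add (posSemidef_real_smul hJ' ht), ?_, ?_⟩
    · convert (posSemidef_real_smul hJψ hs).add (posSemidef_real_smul hJψ' ht) using 1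
      have : choi ψ = (s + t) • choi ψ := by rw [hst, one_smul]
      conv_lhs => rw [this]
      module
    · have : ∀ (s : ℝ) (J : Matrix (a × b) (a × b) ℂ), ptrace (s • J) = s • ptrace J :=
        fun s J => (ptrace (a := a) (b := b)).map_smul_of_tower s J
      rw [map_add, this, this]
      module
  have hKH : ∀ C ∈ K, C.IsHermitian := by
    rintro _ ⟨J, hJ, -, rfl⟩
    exact (ptrace_posSemidef hJ).1.neg
  have hKc : ∀ t : ℝ, IsCompact (K ∩ {C | t ≤ C.trace.re}) := by
    intro t
    have hcpt : IsCompact {J : Matrix (a × b) (a × b) ℂ |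
        (J.PosSemidef ∧ J.trace.re ≤ -t) ∧ (J + choi ψ).PosSemidef} :=
      (isCompact_posSemidef_trace_le (-t)).inter_right
        (isClosed_posSemidef.preimage (continuous_id.add continuous_const))
    convert! hcpt.image (f := fun J => -ptrace J)
      (ptrace.continuous_of_finiteDimensional.neg) using 1
    ext H
    constructor
    · rintro ⟨⟨J, hJ, hJψ, rfl⟩, ht⟩
      refine ⟨J, ⟨⟨hJ, ?_⟩, hJψ⟩, rfl⟩
      have ht' : t ≤ (-ptrace J).trace.re := ht
      rw [Matrix.trace_neg, trace_ptrace, Complex.neg_re] at ht'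
      linarith
    · rintro ⟨J, ⟨⟨hJ, ht⟩, hJψ⟩, rfl⟩
      refine ⟨⟨J, hJ, hJψ, rfl⟩, ?_⟩
      change t ≤ (-ptrace J).trace.re
      rw [Matrix.trace_neg, trace_ptrace, Complex.neg_re]
      linarith
  have hH : (-(c • 1) : Matrix a a ℂ).IsHermitian :=
    (posSemidef_real_smul Matrix.PosSemidef.one hc).1.neg
  have hdom : ∀ σ : Matrix a a ℂ, σ.PosSemidef → ∀ η > (0 : ℝ),
      ∃ C ∈ K, (σ * -(c • 1)).trace.re ≤ (σ * C).trace.re + η := by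
    intro σ hσ η hη
    set d : ℝ := (Fintype.card a : ℝ) with hdd
    have hd : 0 < d := Nat.cast_pos.mpr Fintype.card_pos
    -- The previous lemma needs an invertible weight, so `σ` is perturbed by `δ • 1`; this costs `c
    -- δ d ≤ η`.
    set δ := η / ((c + 1) * d) with hδ
    have hδ0 : 0 < δ := by positivity
    have hδη : c * (δ * d) ≤ η := by
      have : (c + 1) * (δ * d) = η := by rw [hδ]; field_simp
      nlinarith [mul_pos hδ0 hd]
    have hσ' : (σ + δ • 1).PosDef := by
      rw [add_comm]
      exact (Matrix.PosDef.one.smul hδ0).add_posSemidef hσ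
    have htr : (σ + δ • (1 : Matrix a a ℂ)).trace.re = σ.trace.re + δ * d := by
      simp [hdd]
    obtain ⟨J, hJ, hJψ, hle⟩ := exists_small_weighted_trace hψ hψ0 h hσ' (by
      rw [htr]; have := re_trace_nonneg hσ; positivity)
    refine ⟨_, ⟨J, hJ, hJψ, rfl⟩, ?_⟩
    rw [htr, Matrix.add_mul, Matrix.trace_add, Complex.add_re] at hle
    have hnn := re_trace_mul_nonneg (posSemidef_real_smul (Matrix.PosSemidef.one (n := a)) hδ0.le)
      (ptrace_posSemidef hJ)
    have e1 : (σ * -(c • 1)).trace.re = -(c * σ.trace.re) := by simp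
    have e2 : (σ * -ptrace J).trace.re = -(σ * ptrace J).trace.re := by simp
    rw [e1, e2]
    linarith
  obtain ⟨_, ⟨J, hJ, hJψ, rfl⟩, hW⟩ := exists_posSemidef_sub hKconv hKH hKc hH hdom
  set W := -ptrace J - -(c • (1 : Matrix a a ℂ)) with hWd
  -- The slack `W = c • 1 - ptrace J` is spread evenly over `b`, making the partial trace exactly `c
  -- • 1`.
  set V : Matrix (a × b) (a × b) ℂ :=
    Matrix.kroneckerMap (· * ·) W ((Fintype.card b : ℂ)⁻¹ • (1 : Matrix b b ℂ)) with hV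
  have hVpos : V.PosSemidef := hW.kronecker (Matrix.PosSemidef.one.smul (by positivity))
  have hVtr : ptrace V = W := by
    ext i j
    simp [ptrace_apply, hV]
    field_simp
  refine ⟨choi.symm (J + V), ?_, ?_, ?_⟩
  · rw [isCP_iff, choi.apply_symm_apply]
    exact hJ.add hVpos
  · rw [trace_map_eq_mul_iff, choi.apply_symm_apply, map_add, hVtr, hWd]
    ext i j
    simp
  · rw [isCP_iff, map_add, choi.apply_symm_apply, add_right_comm]
    exact hJψ.add hVpos

end Diamond

/-! ### Attainment of the minimum, domination, and its equivalence with (ii). -/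

section Simulation

variable {a : Type u} {a' : Type v} {b : Type w} [Fintype a] [DecidableEq a] [Fintype a']
  [DecidableEq a'] [Fintype b]

theorem isHermitian_choi_sub {Ψ₁ Ψ₂ : MatMap a b} (h₁ : IsChannel Ψ₁) (h₂ : IsChannel Ψ₂) :
    (choi (Ψ₁ - Ψ₂)).IsHermitian := by
  rw [map_sub]
  exact h₁.isHermitian_choi.sub h₂.isHermitian_choi

omit [DecidableEq a] in
theorem trace_sub_apply_eq_zero {Ψ₁ Ψ₂ : MatMap a b} (h₁ : IsChannel Ψ₁) (h₂ : IsChannel Ψ₂)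
    (X : Matrix a a ℂ) : ((Ψ₁ - Ψ₂) X).trace = 0 := by
  rw [LinearMap.sub_apply, Matrix.trace_sub, h₁.2, h₂.2, sub_self]

theorem diamondNorm_sub_le [DecidableEq b] {Ψ₁ Ψ₂ Q : MatMap a b} (h₁ : IsChannel Ψ₁)
    (h₂ : IsChannel Ψ₂) {c : ℝ} (hc : 0 ≤ c) (hQ : IsCP Q)
    (hQc : ∀ X, (Q X).trace = c * X.trace) (hQψ : IsCP (Q + (Ψ₁ - Ψ₂))) :
    diamondNorm (Ψ₁ - Ψ₂) ≤ 2 * c := by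
  refine Real.sSup_le ?_ (by positivity)
  rintro t ⟨ρ, hρ, rfl⟩
  exact traceNorm_tensorId_le (isHermitian_choi_sub h₁ h₂) (trace_sub_apply_eq_zero h₁ h₂)
    hQ hQc hQψ hρ

theorem traceNorm_le_diamondNorm_sub [DecidableEq b] {Ψ₁ Ψ₂ : MatMap a b} (h₁ : IsChannel Ψ₁)
    (h₂ : IsChannel Ψ₂) {ρ : Matrix (a × a) (a × a) ℂ} (hρ : IsState ρ) :
    traceNorm (tensorId (Ψ₁ - Ψ₂) ρ) ≤ diamondNorm (Ψ₁ - Ψ₂) := by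
  -- Boundedness holds because `Ψ₂` itself dominates: `Ψ₂ + (Ψ₁ - Ψ₂) = Ψ₁` is completely positive.
  refine le_csSup ⟨2 * 1, ?_⟩ ⟨ρ, hρ, rfl⟩
  rintro t ⟨ρ, hρ, rfl⟩
  exact traceNorm_tensorId_le (isHermitian_choi_sub h₁ h₂) (trace_sub_apply_eq_zero h₁ h₂)
    h₂.1 (fun X => by simp [h₂.2]) (by simpa using h₁.1) hρ

theorem diamondNorm_nonneg [DecidableEq b] (φ : MatMap a b) :
    0 ≤ diamondNorm φ := by
  refine Real.sSup_nonneg ?_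
  rintro t ⟨ρ, -, rfl⟩
  exact Finset.sum_nonneg fun i _ => Real.sqrt_nonneg _

theorem exists_isCP_dominating_sub [Nonempty a] [DecidableEq b] [Nonempty b] {Ψ₁ Ψ₂ : MatMap a b}
    (h₁ : IsChannel Ψ₁) (h₂ : IsChannel Ψ₂) {c : ℝ} (hc : diamondNorm (Ψ₁ - Ψ₂) ≤ 2 * c) :
    ∃ Q : MatMap a b, IsCP Q ∧ (∀ X, (Q X).trace = c * X.trace) ∧ IsCP (Q + (Ψ₁ - Ψ₂)) := by
  have h0 := diamondNorm_nonneg (Ψ₁ - Ψ₂)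
  exact exists_isCP_dominating (by linarith) (isHermitian_choi_sub h₁ h₂)
    (trace_sub_apply_eq_zero h₁ h₂)
    fun ρ hρ => (traceNorm_le_diamondNorm_sub h₁ h₂ hρ).trans hc

/-- Postcomposition with `Φ`, in terms of Choi operators. -/
def choiComp (Φ : MatMap a b) : Matrix (a' × a) (a' × a) ℂ →ₗ[ℂ] Matrix (a' × b) (a' × b) ℂ where
  toFun L := choi (Φ ∘ₗ choi.symm L)
  map_add' L L' := by rw [map_add, LinearMap.comp_add, map_add]
  map_smul' c L := by rw [map_smul, LinearMap.comp_smul, map_smul, RingHom.id_apply]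

omit [Fintype a] [DecidableEq a] [Fintype b] in
theorem choiComp_choi (Φ : MatMap a b) (Λ : MatMap a' a) :
    choiComp Φ (choi Λ) = choi (Φ ∘ₗ Λ) := by
  simp [choiComp]

-- Continuity of the diamond norm is avoided: the continuous coordinate `c` is minimized over the
-- compact set of triples (`Λ`, `Q`, `c`) with `Q` dominating, and its minimum is half the optimal
-- distance.
omit [DecidableEq a] in
theorem exists_isMinOn_diamondNorm [Nonempty a] [Nonempty a'] [DecidableEq b] [Nonempty b]
    {Φ₁ : MatMap a b} (hΦ₁ : IsChannel Φ₁) {Φ₂ : MatMap a' b} (hΦ₂ : IsChannel Φ₂) :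
    ∃ Λ : MatMap a' a, IsChannel Λ ∧ ∀ Λ' : MatMap a' a, IsChannel Λ' →
      diamondNorm (Φ₁ ∘ₗ Λ - Φ₂) ≤ diamondNorm (Φ₁ ∘ₗ Λ' - Φ₂) := by
  let Z : Set (Matrix (a' × a) (a' × a) ℂ × Matrix (a' × b) (a' × b) ℂ × ℝ) :=
    ({L | L.PosSemidef ∧ ptrace L = ((1 : ℝ) : ℂ) • 1} ×ˢ
      {Q | Q.PosSemidef ∧ Q.trace.re ≤ (Fintype.card a' : ℝ)} ×ˢ Set.Icc 0 1) ∩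
    ({z | ptrace z.2.1 = (z.2.2 : ℂ) • 1} ∩
      {z | (z.2.1 + (choiComp Φ₁ z.1 - choi Φ₂)).PosSemidef})
  have hZ : IsCompact Z := by
    refine IsCompact.inter_right ((isCompact_choi 1).prod
      ((isCompact_posSemidef_trace_le _).prod isCompact_Icc)) (IsClosed.inter ?_ ?_)
    · exact isClosed_eq (ptrace.continuous_of_finiteDimensional.comp (by fun_prop)) (by fun_prop)
    · have : Continuous fun z : Matrix (a' × a) (a' × a) ℂ × Matrix (a' × b) (a' × b) ℂ × ℝ =>
          z.2.1 + (choiComp Φ₁ z.1 - choi Φ₂) :=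
        (by fun_prop : Continuous fun z : Matrix (a' × a) (a' × a) ℂ ×
            Matrix (a' × b) (a' × b) ℂ × ℝ => z.2.1).add
          (((choiComp Φ₁).continuous_of_finiteDimensional.comp continuous_fst).sub
            continuous_const)
      exact isClosed_posSemidef.preimage this
  have hmem : ∀ (Λ : MatMap a' a) (Q : MatMap a' b) (c : ℝ), IsChannel Λ → IsCP Q →
      (∀ X, (Q X).trace = c * X.trace) → IsCP (Q + (Φ₁ ∘ₗ Λ - Φ₂)) → 0 ≤ c → c ≤ 1 →
      (choi Λ, choi Q, c) ∈ Z := by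
    intro Λ Q c hΛ hQ hQc hQψ h0 h1
    have hpt := trace_map_eq_mul_iff.mp hQc
    refine ⟨⟨by simpa using isChannel_iff.mp hΛ, ⟨isCP_iff.mp hQ, ?_⟩, h0, h1⟩, hpt, ?_⟩
    · rw [← trace_ptrace, hpt]
      simp
      nlinarith [(Nat.cast_nonneg (Fintype.card a') : (0 : ℝ) ≤ _)]
    · have := isCP_iff.mp hQψ
      rwa [map_add, map_sub, ← choiComp_choi] at this
  have hφ₂ : ∀ Λ : MatMap a' a, IsChannel Λ → (choi Λ, choi Φ₂, (1 : ℝ)) ∈ Z := fun Λ hΛ =>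
    hmem Λ Φ₂ 1 hΛ hΦ₂.1 (fun X => by simp [hΦ₂.2]) (by simpa using (hΦ₁.comp hΛ).1)
      zero_le_one le_rfl
  obtain ⟨Λ₀, hΛ₀⟩ := exists_isChannel (a := a') (b := a)
  obtain ⟨⟨L, Q, c⟩, hz, hmin⟩ := hZ.exists_isMinOn ⟨_, hφ₂ Λ₀ hΛ₀⟩
    (f := fun z => z.2.2) (by fun_prop)
  obtain ⟨⟨⟨hL, hL1⟩, ⟨hQ, -⟩, hc0, hc1⟩, hpt, hdom⟩ := hz
  have hΛ : IsChannel (choi.symm L) := by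
    rw [isChannel_iff, choi.apply_symm_apply]
    exact ⟨hL, by simpa using hL1⟩
  refine ⟨choi.symm L, hΛ, fun Λ' hΛ' => ?_⟩
  have hle : diamondNorm (Φ₁ ∘ₗ choi.symm L - Φ₂) ≤ 2 * c := by
    refine diamondNorm_sub_le (Q := choi.symm Q) (hΦ₁.comp hΛ) hΦ₂ hc0 ?_ ?_ ?_
    · rwa [isCP_iff, choi.apply_symm_apply]
    · rw [trace_map_eq_mul_iff, choi.apply_symm_apply]
      exact hpt
    · rw [isCP_iff, map_add, map_sub, choi.apply_symm_apply]
      exact hdom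
  refine hle.trans ?_
  -- Triples in `Z` have `c ≤ 1`; a distance above `2` would exceed `2 * c` anyway.
  by_cases h1 : diamondNorm (Φ₁ ∘ₗ Λ' - Φ₂) ≤ 2 * 1
  · obtain ⟨Q', hQ', hQc', hQψ'⟩ := exists_isCP_dominating_sub (hΦ₁.comp hΛ') hΦ₂
      (c := diamondNorm (Φ₁ ∘ₗ Λ' - Φ₂) / 2) (by linarith)
    have h0 := diamondNorm_nonneg (Φ₁ ∘ₗ Λ' - Φ₂)
    have : c ≤ diamondNorm (Φ₁ ∘ₗ Λ' - Φ₂) / 2 :=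
      hmin (hmem Λ' Q' _ hΛ' hQ' hQc' hQψ' (by linarith) (by linarith))
    linarith
  · have hc1' : c ≤ 1 := hc1
    linarith

omit [DecidableEq a] in
theorem isLeast_deltaPre [Nonempty a] [Nonempty a'] [DecidableEq b] [Nonempty b]
    {Φ₁ : MatMap a b} (hΦ₁ : IsChannel Φ₁) {Φ₂ : MatMap a' b} (hΦ₂ : IsChannel Φ₂) :
    IsLeast (preDistances Φ₁ Φ₂) (deltaPre Φ₁ Φ₂) := by
  obtain ⟨Λ, hΛ, hmin⟩ := exists_isMinOn_diamondNorm hΦ₁ hΦ₂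
  have h : IsLeast (preDistances Φ₁ Φ₂) (diamondNorm (Φ₁ ∘ₗ Λ - Φ₂)) := by
    refine ⟨⟨Λ, hΛ, rfl⟩, ?_⟩
    rintro d ⟨Λ', hΛ', rfl⟩
    exact hmin Λ' hΛ'
  rwa [deltaPre, h.csInf_eq]

/-- `Φ₂` is dominated by `Φ₁`, after preprocessing, plus `c` times a channel. -/
def DominatedUpTo (Φ₁ : MatMap a b) (Φ₂ : MatMap a' b) (c : ℝ) : Prop :=
  ∃ (Λ : MatMap a' a) (β : MatMap a' b), IsChannel Λ ∧ IsChannel β ∧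
    IsCP ((c : ℂ) • β + (Φ₁ ∘ₗ Λ - Φ₂))

omit [DecidableEq a] in
theorem deltaPre_le_iff [Nonempty a] [Nonempty a'] [DecidableEq b] [Nonempty b]
    {Φ₁ : MatMap a b} (hΦ₁ : IsChannel Φ₁) {Φ₂ : MatMap a' b} (hΦ₂ : IsChannel Φ₂) {ε : ℝ}
    (hε : 0 ≤ ε) : deltaPre Φ₁ Φ₂ ≤ ε ↔ DominatedUpTo Φ₁ Φ₂ (ε / 2) := by
  have hleast := isLeast_deltaPre hΦ₁ hΦ₂
  constructor
  · intro h
    obtain ⟨Λ, hΛ, hd⟩ := hleast.1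
    obtain ⟨Q, hQ, hQc, hQψ⟩ := exists_isCP_dominating_sub (hΦ₁.comp hΛ) hΦ₂ (c := ε / 2)
      (by rw [← hd]; linarith)
    obtain ⟨β, hβ, rfl⟩ := hQ.exists_channel_smul (by linarith) hQc
    exact ⟨Λ, β, hΛ, hβ, hQψ⟩
  · rintro ⟨Λ, β, hΛ, hβ, h⟩
    refine (hleast.2 ⟨Λ, hΛ, rfl⟩).trans ((diamondNorm_sub_le (c := ε / 2) (hΦ₁.comp hΛ) hΦ₂
      (by linarith) (hβ.1.smul ?_) (fun X => ?_) h).trans (by linarith))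
    · exact_mod_cast (by linarith : 0 ≤ ε / 2)
    · rw [LinearMap.smul_apply, Matrix.trace_smul, hβ.2, smul_eq_mul]

omit [Fintype a'] [DecidableEq a'] [Fintype a] [DecidableEq a] [Fintype b] in
theorem isCP_id : IsCP (LinearMap.id : MatMap a a) := fun _ _ hX => hX

omit [DecidableEq a] in
theorem isChannel_id : IsChannel (LinearMap.id : MatMap a a) := ⟨isCP_id, fun _ => rfl⟩

variable {r : Type*} [Fintype r]

theorem DominatedUpTo.dualNorm_le [Nonempty a] [Nonempty a'] [Nonempty b] {Φ₁ : MatMap a b}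
    (hΦ₁ : IsCP Φ₁) {Φ₂ : MatMap a' b} (hΦ₂ : IsCP Φ₂) {c : ℝ} (hc : 0 ≤ c)
    (h : DominatedUpTo Φ₁ Φ₂ c) {ρ : Matrix (r × b) (r × b) ℂ} (hρ : ρ.PosSemidef) :
    dualNorm (idTensor (transposeMap Φ₂) ρ) ≤
      dualNorm (idTensor (transposeMap Φ₁) ρ) + c * dualNorm ρ := by
  classical
  obtain ⟨Λ, β, hΛ, hβ, hcp⟩ := h
  obtain ⟨α₀, hα₀⟩ := exists_isChannel (a := r) (b := a')
  rw [dualNorm_idTensor_eq hΦ₂ hρ]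
  refine csSup_le ⟨_, α₀, hα₀, rfl⟩ ?_
  rintro t ⟨α, hα, rfl⟩
  have h0 := re_pairing_nonneg hρ (hcp.comp hα.1)
  have heq : pairing ρ (((c : ℂ) • β + (Φ₁ ∘ₗ Λ - Φ₂)) ∘ₗ α) =
      c * pairing ρ (β ∘ₗ α) + (pairing ρ (Φ₁ ∘ₗ (Λ ∘ₗ α)) - pairing ρ (Φ₂ ∘ₗ α)) := by
    rw [LinearMap.add_comp, LinearMap.sub_comp, LinearMap.smul_comp, LinearMap.comp_assoc]
    simp only [← pairingLin_apply, map_add, map_sub, map_smul, smul_eq_mul]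
  rw [heq, Complex.add_re, Complex.sub_re, Complex.re_ofReal_mul] at h0
  have h1 := re_pairing_comp_le_dualNorm hΦ₁ hρ (hΛ.comp hα)
  have h2 := mul_le_mul_of_nonneg_left (re_pairing_le_dualNorm hρ (hβ.comp hα)) hc
  linarith

/-- The success probability as a linear functional of the applied map. -/
def gameLin {k : ℕ} (lam : Fin k → ℝ) (ρ : Fin k → Matrix (a × r) (a × r) ℂ)
    (M : Fin k → Matrix (b × r) (b × r) ℂ) : MatMap a b →ₗ[ℂ] ℂ where
  toFun φ := ∑ i, (lam i : ℂ) * (tensorId φ (ρ i) * M i).trace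
  map_add' φ ψ := by
    simp [tensorId_add, Matrix.add_mul, mul_add, Finset.sum_add_distrib]
  map_smul' c φ := by
    have : ∀ X : Matrix (a × r) (a × r) ℂ, tensorId (c • φ) X = c • tensorId φ X := fun _ => rfl
    simp only [this, Matrix.smul_mul, Matrix.trace_smul, smul_eq_mul, Finset.mul_sum,
      RingHom.id_apply]
    exact Finset.sum_congr rfl fun i _ => by ring

omit [DecidableEq a] [Fintype a] in
theorem succProb_eq_re_gameLin {k : ℕ} (lam : Fin k → ℝ) (ρ : Fin k → Matrix (a × r) (a × r) ℂ)
    (M : Fin k → Matrix (b × r) (b × r) ℂ) (φ : MatMap a b) :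
    succProb lam (fun i => tensorId φ (ρ i)) M = (gameLin lam ρ M φ).re := by
  simp [succProb, gameLin, Complex.re_sum]

theorem re_gameLin_nonneg {k : ℕ} {lam : Fin k → ℝ} (hlam : ∀ i, 0 ≤ lam i)
    {ρ : Fin k → Matrix (a × r) (a × r) ℂ} (hρ : ∀ i, (ρ i).PosSemidef)
    {M : Fin k → Matrix (b × r) (b × r) ℂ} (hM : ∀ i, (M i).PosSemidef) {φ : MatMap a b}
    (hφ : IsCP φ) : 0 ≤ (gameLin lam ρ M φ).re := by
  rw [← succProb_eq_re_gameLin]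
  exact Finset.sum_nonneg fun i _ => mul_nonneg (hlam i)
    (re_trace_mul_nonneg (hφ.tensorId_posSemidef (hρ i)) (hM i))

theorem succProb_le_optSuccProb {k : ℕ} {lam : Fin k → ℝ}
    {ρ : Fin k → Matrix a a ℂ} (h : IsEnsemble lam ρ) {M : Fin k → Matrix a a ℂ}
    (hM : IsMeasurement M) : succProb lam ρ M ≤ optSuccProb lam ρ := by
  refine le_csSup ⟨1, ?_⟩ ⟨M, hM, rfl⟩
  rintro t ⟨M, hM, rfl⟩
  rw [← h.2.1]
  refine Finset.sum_le_sum fun i _ => mul_le_of_le_one_right (h.1 i) ?_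
  have h1 : (1 - M i).PosSemidef := by
    rw [← hM.2, ← Finset.add_sum_erase _ _ (Finset.mem_univ i), add_sub_cancel_left]
    exact Matrix.posSemidef_sum _ fun j _ => hM.1 j
  have h2 := re_trace_mul_nonneg (h.2.2 i).1 h1
  rw [Matrix.mul_sub, mul_one, Matrix.trace_sub, Complex.sub_re, (h.2.2 i).2, Complex.one_re] at h2
  linarith

theorem preSuccProb_eq_sSup {c : Type*} [Fintype c] [DecidableEq b] (Φ : MatMap a b) {k : ℕ}
    (M : Fin k → Matrix (b × c) (b × c) ℂ) (lam : Fin k → ℝ)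
    (ρ : Fin k → Matrix (r × c) (r × c) ℂ) :
    preSuccProb Φ M lam ρ = sSup {t : ℝ | ∃ α : MatMap r a, IsChannel α ∧
      t = (gameLin lam ρ M (Φ ∘ₗ α)).re} := by
  simp only [preSuccProb, succProb_tensorId]
  simp only [succProb_eq_re_gameLin]

theorem re_gameLin_comp_le_preSuccProb {c : Type*} [Fintype c] [DecidableEq b] (Φ : MatMap a b)
    {k : ℕ} (M : Fin k → Matrix (b × c) (b × c) ℂ) (lam : Fin k → ℝ)
    (ρ : Fin k → Matrix (r × c) (r × c) ℂ) {α : MatMap r a} (hα : IsChannel α) :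
    (gameLin lam ρ M (Φ ∘ₗ α)).re ≤ preSuccProb Φ M lam ρ := by
  classical
  rw [preSuccProb_eq_sSup]
  let F : MatMap r a →ₗ[ℂ] ℂ := gameLin lam ρ M ∘ₗ LinearMap.llcomp ℂ _ _ _ Φ
  exact le_csSup (bddAbove_channels F) ⟨α, hα, rfl⟩

theorem DominatedUpTo.preSuccProb_le {d : Type*} [Fintype d] [DecidableEq d] [DecidableEq r]
    [DecidableEq b] [Nonempty a'] {Φ₁ : MatMap a b}
    {Φ₂ : MatMap a' b} {c : ℝ} (hc : 0 ≤ c) (h : DominatedUpTo Φ₁ Φ₂ c)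
    {k : ℕ} {M : Fin k → Matrix (b × d) (b × d) ℂ} {lam : Fin k → ℝ}
    {ρ : Fin k → Matrix (r × d) (r × d) ℂ} (hE : IsEnsemble lam ρ) (hM : IsMeasurement M) :
    preSuccProb Φ₂ M lam ρ ≤ preSuccProb Φ₁ M lam ρ + c * optSuccProb lam ρ := by
  obtain ⟨Λ, β, hΛ, hβ, hcp⟩ := h
  obtain ⟨α₀, hα₀⟩ := exists_isChannel (a := r) (b := a')
  rw [preSuccProb_eq_sSup Φ₂]
  refine csSup_le ⟨_, α₀, hα₀, rfl⟩ ?_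
  rintro t ⟨α, hα, rfl⟩
  have h0 := re_gameLin_nonneg hE.1 (fun i => (hE.2.2 i).1) hM.1 (hcp.comp hα.1)
  have heq : gameLin lam ρ M (((c : ℂ) • β + (Φ₁ ∘ₗ Λ - Φ₂)) ∘ₗ α) =
      c * gameLin lam ρ M (β ∘ₗ α) +
        (gameLin lam ρ M (Φ₁ ∘ₗ (Λ ∘ₗ α)) - gameLin lam ρ M (Φ₂ ∘ₗ α)) := by
    rw [LinearMap.add_comp, LinearMap.sub_comp, LinearMap.smul_comp, LinearMap.comp_assoc]
    simp only [map_add, map_sub, map_smul, smul_eq_mul]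
  rw [heq, Complex.add_re, Complex.sub_re, Complex.re_ofReal_mul] at h0
  have h1 := re_gameLin_comp_le_preSuccProb Φ₁ M lam ρ (hΛ.comp hα)
  -- The channel `β ∘ α` is absorbed into the measurement, leaving an ordinary measurement on the
  -- original ensemble.
  have h2 : (gameLin lam ρ M (β ∘ₗ α)).re ≤ optSuccProb lam ρ := by
    rw [← succProb_eq_re_gameLin]
    convert succProb_le_optSuccProb hE (hM.tensorId_traceAdjoint (hβ.comp hα)) using 1
    simp only [succProb, trace_tensorId_mul]
  have h3 := mul_le_mul_of_nonneg_left h2 hc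
  linarith

theorem exists_channel_gt_of_lt_sSup [Nonempty b] {F : MatMap a b → ℝ} {t : ℝ}
    (h : t < sSup {t : ℝ | ∃ α, IsChannel α ∧ t = F α}) : ∃ α, IsChannel α ∧ t < F α := by
  obtain ⟨α₀, hα₀⟩ := exists_isChannel (a := a) (b := b)
  obtain ⟨_, ⟨α, hα, rfl⟩, hlt⟩ := exists_lt_of_lt_csSup
    (s := {t : ℝ | ∃ α, IsChannel α ∧ t = F α}) ⟨_, α₀, hα₀, rfl⟩ h
  exact ⟨α, hα, hlt⟩

omit [Fintype a] in
theorem convex_choi (c : ℝ) :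
    Convex ℝ {C : Matrix (a × b) (a × b) ℂ | C.PosSemidef ∧ ptrace C = (c : ℂ) • 1} := by
  rintro L ⟨hL, hL1⟩ L' ⟨hL', hL1'⟩ s t hs ht hst
  refine ⟨(posSemidef_real_smul hL hs).add (posSemidef_real_smul hL' ht), ?_⟩
  rw [map_add, LinearMap.map_smul_of_tower, LinearMap.map_smul_of_tower, hL1, hL1', ← add_smul,
    hst, one_smul]

/-- Domination follows from the comparison of dual norms with the input system as ancilla. -/
theorem dominatedUpTo_of_dualNorm_le [Nonempty a] [DecidableEq b] [Nonempty b] {Φ₁ : MatMap a b}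
    (hΦ₁ : IsChannel Φ₁) {Φ₂ : MatMap a' b} (hΦ₂ : IsChannel Φ₂) [Nonempty a'] {c : ℝ} (hc : 0 ≤ c)
    (h : ∀ ρ : Matrix (a' × b) (a' × b) ℂ, IsState ρ →
      dualNorm (idTensor (transposeMap Φ₂) ρ) ≤
        dualNorm (idTensor (transposeMap Φ₁) ρ) + c * dualNorm ρ) :
    DominatedUpTo Φ₁ Φ₂ c := by
  obtain ⟨Λ₀, hΛ₀⟩ := exists_isChannel (a := a') (b := a)
  set S : Set (Matrix (a' × a) (a' × a) ℂ × Matrix (a' × b) (a' × b) ℂ) :=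
    {L | L.PosSemidef ∧ ptrace L = ((1 : ℝ) : ℂ) • 1} ×ˢ
      {B | B.PosSemidef ∧ ptrace B = ((1 : ℝ) : ℂ) • 1} with hS
  let T : Matrix (a' × a) (a' × a) ℂ × Matrix (a' × b) (a' × b) ℂ →ₗ[ℂ]
      Matrix (a' × b) (a' × b) ℂ := (choiComp Φ₁).coprod ((c : ℂ) • LinearMap.id)
  have hTS : ∀ C ∈ T '' S, ∃ (Λ : MatMap a' a) (β : MatMap a' b), IsChannel Λ ∧ IsChannel β ∧
      C = choi (Φ₁ ∘ₗ Λ) + (c : ℂ) • choi β := by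
    rintro _ ⟨⟨L, B⟩, ⟨hL, hB⟩, rfl⟩
    refine ⟨choi.symm L, choi.symm B, ?_, ?_, ?_⟩
    · rw [isChannel_iff, choi.apply_symm_apply]
      simpa using hL
    · rw [isChannel_iff, choi.apply_symm_apply]
      simpa using hB
    · rw [← choiComp_choi]
      simp [T]
  have hmem : ∀ (Λ : MatMap a' a) (β : MatMap a' b), IsChannel Λ → IsChannel β →
      choi (Φ₁ ∘ₗ Λ) + (c : ℂ) • choi β ∈ T '' S := by
    intro Λ β hΛ hβ
    refine ⟨(choi Λ, choi β), ⟨by simpa using isChannel_iff.mp hΛ,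
      by simpa using isChannel_iff.mp hβ⟩, ?_⟩
    simp [T, choiComp_choi]
  have hcomp : IsCompact (T '' S) :=
    ((isCompact_choi 1).prod (isCompact_choi 1)).image T.continuous_of_finiteDimensional
  have hKconv : Convex ℝ (T '' S) :=
    ((convex_choi 1).prod (convex_choi 1)).linear_image (T.restrictScalars ℝ)
  obtain ⟨C, hC, hCH⟩ := exists_posSemidef_sub (K := T '' S) (H := choi Φ₂) hKconv
    (fun C hC => by
      obtain ⟨Λ, β, hΛ, hβ, rfl⟩ := hTS C hC
      refine (hΦ₁.comp hΛ).isHermitian_choi.add (Matrix.PosSemidef.smul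
        (isChannel_iff.mp hβ).1 ?_).1
      exact_mod_cast hc)
    (fun t => hcomp.inter_right (isClosed_le (f := fun _ => t)
      (g := fun C : Matrix (a' × b) (a' × b) ℂ => C.trace.re) continuous_const (by fun_prop)))
    hΦ₂.isHermitian_choi
    (fun σ hσ η hη => by
      -- A positive functional of the Choi operator is the pairing with a positive operator, after a
      -- transpose; dividing by its trace yields a state to which `h` applies.
      have hpair : ∀ φ : MatMap a' b, (σ * choi φ).trace = pairing σ.transpose φ := fun φ => by
        rw [pairing_eq_trace, ← Matrix.transpose_mul, Matrix.trace_transpose,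
          Matrix.trace_mul_comm]
      have hτ0 := re_trace_nonneg hσ
      rcases hτ0.eq_or_lt with h0 | hpos
      · have hσ0 : σ = 0 := by
          rw [← hσ.trace_eq_zero_iff, trace_eq_re hσ, ← h0, Complex.ofReal_zero]
        exact ⟨_, hmem Λ₀ Φ₂ hΛ₀ hΦ₂, by simp [hσ0, hη.le]⟩
      · set τ := σ.trace.re with hτ
        have hτ' : (τ : ℂ) ≠ 0 := by exact_mod_cast hpos.ne'
        set ρ : Matrix (a' × b) (a' × b) ℂ := (τ : ℂ)⁻¹ • σ.transpose with hρd
        have hρ : IsState ρ := by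
          refine ⟨hσ.transpose.smul ?_, ?_⟩
          · rw [← Complex.ofReal_inv]
            exact_mod_cast (inv_nonneg.mpr hpos.le)
          · rw [hρd, Matrix.trace_smul, Matrix.trace_transpose, trace_eq_re hσ, smul_eq_mul,
              inv_mul_cancel₀ hτ']
        have hpair' : ∀ φ : MatMap a' b, (σ * choi φ).trace.re = τ * (pairing ρ φ).re :=
          fun φ => by
            rw [hpair, ← Complex.re_ofReal_mul]
            congr 1
            rw [pairing_eq_trace, pairing_eq_trace, hρd, Matrix.smul_mul, Matrix.trace_smul,
              smul_eq_mul, mul_inv_cancel_left₀ hτ']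
        -- Two suprema are approximated, one weighted by `c`, and the result is rescaled by `τ`; the
        -- total error is then `η`.
        have hη' : 0 < η / (τ * (1 + c)) := by positivity
        -- Here the ancilla is the input system of `Φ₂`, so the identity is an admissible
        -- preprocessing channel.
        have h2 := (re_pairing_comp_le_dualNorm hΦ₂.1 hρ.1 isChannel_id).trans (h ρ hρ)
        rw [LinearMap.comp_id, dualNorm_idTensor_eq hΦ₁.1 hρ.1, dualNorm_posSemidef_eq hρ.1] at h2
        obtain ⟨Λ, hΛ, hlt⟩ := exists_channel_gt_of_lt_sSup (sub_lt_self
          (sSup {t : ℝ | ∃ Λ : MatMap a' a, IsChannel Λ ∧ t = (pairing ρ (Φ₁ ∘ₗ Λ)).re}) hη')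
        obtain ⟨β, hβ, hlt'⟩ := exists_channel_gt_of_lt_sSup (sub_lt_self
          (sSup {t : ℝ | ∃ β : MatMap a' b, IsChannel β ∧ t = (pairing ρ β).re}) hη')
        refine ⟨_, hmem Λ β hΛ hβ, ?_⟩
        rw [Matrix.mul_add, Matrix.trace_add, Matrix.mul_smul, Matrix.trace_smul, smul_eq_mul,
          Complex.add_re, Complex.re_ofReal_mul, hpair', hpair', hpair']
        have h3 : (pairing ρ Φ₂).re ≤ (pairing ρ (Φ₁ ∘ₗ Λ)).re + c * (pairing ρ β).re +
            (1 + c) * (η / (τ * (1 + c))) := by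
          nlinarith [mul_le_mul_of_nonneg_left hlt'.le hc]
        have h4 := mul_le_mul_of_nonneg_left h3 hpos.le
        have h5 : τ * ((1 + c) * (η / (τ * (1 + c)))) = η := by field_simp
        nlinarith)
  obtain ⟨Λ, β, hΛ, hβ, rfl⟩ := hTS C hC
  refine ⟨Λ, β, hΛ, hβ, ?_⟩
  rw [isCP_iff, map_add, map_sub, map_smul]
  convert hCH using 1
  abel

end Simulation

/-! ### Weyl unitaries and the reduction of (ii) to a guessing game. -/

section Twirl

/-- A finite family of unitaries (the discrete Weyl operators) forming an orthogonal basis up to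
multiplicity. -/
theorem exists_unitary_twirl (b : Type*) [Fintype b] [DecidableEq b] [Nonempty b] :
    ∃ (k : ℕ) (U : Fin k → Matrix b b ℂ), 0 < k ∧ (∀ i, (U i).conjTranspose * U i = 1) ∧
      ∀ x y x' y', (Fintype.card b : ℂ) * ∑ i, U i y x * star (U i y' x') =
        if x = x' ∧ y = y' then (k : ℂ) else 0 := by
  have : NeZero (Fintype.card b) := ⟨Fintype.card_ne_zero⟩
  let G := ZMod (Fintype.card b)
  let e : b ≃ G := Fintype.equivOfCardEq (ZMod.card _).symm
  let ι := G × AddChar G ℂ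
  let f : ι ≃ Fin (Fintype.card ι) := Fintype.equivFin ι
  -- With `b` identified with a cyclic group, the operator indexed by `(s, χ)` sends `|x⟩` to `χ(x)
  -- |x + s⟩`.
  let V : ι → Matrix b b ℂ := fun p => Matrix.of fun y x => if e y = e x + p.1 then p.2 (e x) else 0
  have hstar : ∀ (χ : AddChar G ℂ) (g : G), χ g * star (χ g) = 1 := fun χ g => by
    rw [Complex.star_def, ← AddChar.map_neg_eq_conj, ← AddChar.map_add_eq_mul, add_neg_cancel,
      AddChar.map_zero_eq_one]
  have hunit : ∀ p : ι, (V p).conjTranspose * V p = 1 := by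
    rintro ⟨s, χ⟩
    ext x x'
    rw [Matrix.mul_apply, Finset.sum_eq_single (e.symm (e x + s))]
    · simp only [Matrix.conjTranspose_apply, V, Matrix.of_apply, Equiv.apply_symm_apply, if_true,
        add_left_inj, EmbeddingLike.apply_eq_iff_eq, Matrix.one_apply]
      split_ifs with h
      · rw [← h, mul_comm, hstar]
      · simp
    · intro y _ hy
      have : e y ≠ e x + s := fun h => hy (by rw [← h, Equiv.symm_apply_apply])
      simp [V, this]
    · simp
  refine ⟨Fintype.card ι, fun i => V (f.symm i), Fintype.card_pos, fun i => hunit _,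
    fun x y x' y' => ?_⟩
  · rw [Equiv.sum_comp f.symm (fun p => V p y x * star (V p y' x')), Fintype.sum_prod_type]
    -- The entry at `(y, x)` forces the shift `s = y - x`; orthogonality of characters then forces
    -- `x = x'`, hence `y = y'`.
    have hsum : ∀ s : G, ∑ χ : AddChar G ℂ, V (s, χ) y x * star (V (s, χ) y' x') =
        if s = e y - e x then (if x = x' ∧ y = y' then (Fintype.card b : ℂ) else 0) else 0 := by
      intro s
      simp only [V, Matrix.of_apply]
      by_cases hs : s = e y - e x
      · have h1 : e y = e x + s := by rw [hs]; abel
        rw [if_pos hs]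
        simp only [if_pos h1]
        by_cases h2 : e y' = e x' + s
        · simp only [if_pos h2]
          have h3 : ∀ χ : AddChar G ℂ, χ (e x) * star (χ (e x')) = χ (e x - e x') := fun χ => by
            rw [Complex.star_def, ← AddChar.map_neg_eq_conj, ← AddChar.map_add_eq_mul,
              sub_eq_add_neg]
          simp only [h3, AddChar.sum_apply_eq_ite, sub_eq_zero, EmbeddingLike.apply_eq_iff_eq]
          by_cases h4 : x = x'
          · have h5 : y = y' := e.injective (by rw [h1, h2, h4])
            simp [h4, h5, G, ZMod.card]
          · simp [h4]
        · have h4 : ¬(x = x' ∧ y = y') := by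
            rintro ⟨rfl, rfl⟩
            exact h2 h1
          simp [h2, h4]
      · have h1 : e y ≠ e x + s := fun h => hs (by rw [h]; abel)
        simp [h1, hs]
    simp only [hsum, Finset.sum_ite_eq', Finset.mem_univ, if_true]
    have hcard : Fintype.card ι = Fintype.card b * Fintype.card b := by
      rw [Fintype.card_prod, AddChar.card_eq, ZMod.card]
    rw [hcard]
    split_ifs <;> simp

variable {a : Type u} {b : Type v} {r : Type w} [Fintype a] [Fintype b] [Fintype r]
  [DecidableEq b] [DecidableEq r]

/-- Conjugation by `1 ⊗ U`. -/
def conjSnd (U : Matrix b b ℂ) (Z : Matrix (r × b) (r × b) ℂ) : Matrix (r × b) (r × b) ℂ :=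
  Matrix.kroneckerMap (· * ·) 1 U * Z * (Matrix.kroneckerMap (· * ·) 1 U).conjTranspose

omit [DecidableEq b] in
theorem conjSnd_apply (U : Matrix b b ℂ) (Z : Matrix (r × b) (r × b) ℂ) (p q : r × b) :
    conjSnd U Z p q = ∑ y, ∑ x, U p.2 x * Z (p.1, x) (q.1, y) * star (U q.2 y) := by
  simp [conjSnd, Matrix.mul_apply, Matrix.one_apply, Fintype.sum_prod_type_right, Finset.sum_mul,
    apply_ite (starRingEnd ℂ)]

theorem kronecker_conjTranspose_mul {U : Matrix b b ℂ} (hU : U.conjTranspose * U = 1) :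
    (Matrix.kroneckerMap (· * ·) (1 : Matrix r r ℂ) U).conjTranspose *
      Matrix.kroneckerMap (· * ·) 1 U = 1 := by
  rw [Matrix.conjTranspose_kronecker, ← Matrix.mul_kronecker_mul, Matrix.conjTranspose_one, one_mul,
    hU, Matrix.one_kronecker_one]

omit [DecidableEq b] in
theorem conjSnd_posSemidef (U : Matrix b b ℂ) {Z : Matrix (r × b) (r × b) ℂ} (hZ : Z.PosSemidef) :
    (conjSnd U Z).PosSemidef := hZ.mul_mul_conjTranspose_same _

omit [DecidableEq b] in
theorem trace_conjSnd_mul {U : Matrix b b ℂ} (X Y : Matrix (r × b) (r × b) ℂ) :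
    (conjSnd U X * Y).trace = (X * conjSnd U.conjTranspose Y).trace := by
  set W := Matrix.kroneckerMap (· * ·) (1 : Matrix r r ℂ) U with hW
  have hW' : Matrix.kroneckerMap (· * ·) (1 : Matrix r r ℂ) U.conjTranspose = W.conjTranspose := by
    rw [hW, Matrix.conjTranspose_kronecker, Matrix.conjTranspose_one]
  rw [conjSnd, conjSnd, ← hW, hW', Matrix.conjTranspose_conjTranspose, mul_assoc, mul_assoc,
    Matrix.trace_mul_comm]
  simp only [mul_assoc]

theorem conjSnd_conjTranspose_conjSnd {U : Matrix b b ℂ} (hU : U.conjTranspose * U = 1)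
    (Z : Matrix (r × b) (r × b) ℂ) : conjSnd U.conjTranspose (conjSnd U Z) = Z := by
  set W := Matrix.kroneckerMap (· * ·) (1 : Matrix r r ℂ) U with hW
  have hW' : Matrix.kroneckerMap (· * ·) (1 : Matrix r r ℂ) U.conjTranspose = W.conjTranspose := by
    rw [hW, Matrix.conjTranspose_kronecker, Matrix.conjTranspose_one]
  have h1 : W.conjTranspose * W = 1 := kronecker_conjTranspose_mul hU
  rw [conjSnd, conjSnd, ← hW, hW', Matrix.conjTranspose_conjTranspose]
  calc _ = (W.conjTranspose * W) * Z * (W.conjTranspose * W) := by simp only [mul_assoc]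
    _ = Z := by rw [h1, one_mul, mul_one]

theorem trace_conjSnd {U : Matrix b b ℂ} (hU : U.conjTranspose * U = 1)
    (Z : Matrix (r × b) (r × b) ℂ) : (conjSnd U Z).trace = Z.trace := by
  rw [conjSnd, Matrix.trace_mul_cycle, kronecker_conjTranspose_mul hU, one_mul]

theorem ptrace_conjSnd {U : Matrix b b ℂ} (hU : U.conjTranspose * U = 1)
    (Z : Matrix (r × b) (r × b) ℂ) : ptrace (conjSnd U Z) = ptrace Z := by
  ext i j
  simp only [ptrace_apply, conjSnd_apply]
  rw [Finset.sum_comm]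
  refine Finset.sum_congr rfl fun y _ => ?_
  rw [Finset.sum_comm]
  have h : ∀ x, ∑ k, U k x * Z (i, x) (j, y) * star (U k y) =
      (if y = x then 1 else 0) * Z (i, x) (j, y) := fun x => by
    have h1 := congrFun (congrFun hU y) x
    rw [Matrix.mul_apply, Matrix.one_apply] at h1
    rw [← h1, Finset.sum_mul]
    exact Finset.sum_congr rfl fun k _ => by
      rw [Matrix.conjTranspose_apply]
      ring
  simp only [h]
  simp

omit [DecidableEq b] in
theorem tensorId_conjSnd [DecidableEq a] (φ : MatMap r a) (U : Matrix b b ℂ)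
    (Z : Matrix (r × b) (r × b) ℂ) : tensorId φ (conjSnd U Z) = conjSnd U (tensorId φ Z) := by
  ext p q
  simp only [tensorId_apply, conjSnd_apply, Finset.sum_mul, Finset.mul_sum]
  simp only [← Finset.sum_product', Finset.univ_product_univ]
  exact Fintype.sum_equiv
    ⟨fun x => (x.2.2.1, x.2.2.2, x.1, x.2.1), fun x => (x.2.2.1, x.2.2.2, x.1, x.2.1),
      fun _ => rfl, fun _ => rfl⟩ _ _ fun x => by simp; ring

/-- The unnormalized maximally entangled operator. -/
def maxEnt (b : Type*) [DecidableEq b] : Matrix (b × b) (b × b) ℂ :=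
  Matrix.vecMulVec (fun p => if p.1 = p.2 then 1 else 0) (star fun p => if p.1 = p.2 then 1 else 0)

omit [Fintype r] [DecidableEq r] in
theorem pairing_eq_trace_maxEnt (X : Matrix (r × b) (r × b) ℂ) (φ : MatMap r b) :
    pairing X φ = (tensorId φ X * maxEnt b).trace := by
  simp only [pairing, maxEnt, Matrix.mul_vecMulVec, Matrix.trace_vecMulVec]
  simp [dotProduct, Matrix.mulVec, Fintype.sum_prod_type]

/-- A comparison of success probabilities in all guessing games implies that of dual norms. -/
theorem dualNorm_le_of_preSuccProb_le {a' : Type*} [Fintype a'] [DecidableEq a] [DecidableEq a']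
    [Nonempty a] [Nonempty a'] [Nonempty b] {Φ₁ : MatMap a b} (hΦ₁ : IsCP Φ₁)
    {Φ₂ : MatMap a' b} (hΦ₂ : IsCP Φ₂) {c : ℝ} (hc : 0 ≤ c)
    (h : ∀ (k : ℕ) (lam : Fin k → ℝ) (ρ : Fin k → Matrix (r × b) (r × b) ℂ)
      (M : Fin k → Matrix (b × b) (b × b) ℂ), IsEnsemble lam ρ → IsMeasurement M →
        preSuccProb Φ₂ M lam ρ ≤ preSuccProb Φ₁ M lam ρ + c * optSuccProb lam ρ)
    {ρ : Matrix (r × b) (r × b) ℂ} (hρ : IsState ρ) :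
    dualNorm (idTensor (transposeMap Φ₂) ρ) ≤
      dualNorm (idTensor (transposeMap Φ₁) ρ) + c * dualNorm ρ := by
  obtain ⟨k, U, hk, hU, hUsum⟩ := exists_unitary_twirl b
  set d : ℝ := (Fintype.card b : ℝ) with hd
  have hd0 : 0 < d := Nat.cast_pos.mpr Fintype.card_pos
  have hk0 : (0 : ℝ) < k := Nat.cast_pos.mpr hk
  have hkC : (k : ℂ) ≠ 0 := Nat.cast_ne_zero.mpr hk.ne'
  have hdC : (Fintype.card b : ℂ) ≠ 0 := Nat.cast_ne_zero.mpr Fintype.card_ne_zero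
  -- This factor makes the rotated maximally entangled operators sum to the identity, by `hUsum`.
  set s : ℝ := d / k with hs
  have hs0 : 0 < s := div_pos hd0 hk0
  let lam : Fin k → ℝ := fun _ => (k : ℝ)⁻¹
  let σ : Fin k → Matrix (r × b) (r × b) ℂ := fun i => conjSnd (U i) ρ
  let M : Fin k → Matrix (b × b) (b × b) ℂ := fun i => s • conjSnd (U i) (maxEnt b)
  have hE : IsEnsemble lam σ := by
    refine ⟨fun _ => by positivity, ?_, fun i => ⟨conjSnd_posSemidef _ hρ.1, ?_⟩⟩
    · simp [lam, hk.ne']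
    · rw [trace_conjSnd (hU i), hρ.2]
  have hM : IsMeasurement M := by
    refine ⟨fun i => posSemidef_real_smul (conjSnd_posSemidef _
      (Matrix.posSemidef_vecMulVec_self_star _)) hs0.le, ?_⟩
    ext ⟨x, y⟩ ⟨x', y'⟩
    have h1 := hUsum x y x' y'
    have h2 : ∀ i, conjSnd (U i) (maxEnt b) (x, y) (x', y') = U i y x * star (U i y' x') := by
      intro i
      simp [conjSnd_apply, maxEnt, Matrix.vecMulVec_apply]
    simp only [M, Matrix.sum_apply, Matrix.smul_apply, h2, Complex.real_smul]
    have h3 : (s : ℂ) = Fintype.card b / k := by simp [hs, hd]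
    rw [h3, ← Finset.mul_sum, div_mul_eq_mul_div, h1]
    by_cases h4 : x = x' ∧ y = y'
    · rw [if_pos h4, h4.1, h4.2, Matrix.one_apply_eq, div_self hkC]
    · rw [if_neg h4, Matrix.one_apply_ne (fun h => h4 (by simpa using h)), zero_div]
  -- The map `φ` acts on the other factor and commutes with the rotation, which cancels against that
  -- of `M i`; every outcome contributes equally.
  have hgame : ∀ φ : MatMap r b, (gameLin lam σ M φ).re = s * (pairing ρ φ).re := by
    intro φ
    have h1 : ∀ i, (tensorId φ (σ i) * M i).trace = s * pairing ρ φ := by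
      intro i
      simp only [σ, M]
      rw [tensorId_conjSnd, Matrix.mul_smul, Matrix.trace_smul, trace_conjSnd_mul,
        conjSnd_conjTranspose_conjSnd (hU i), ← pairing_eq_trace_maxEnt, Complex.real_smul]
    have h2 : gameLin lam σ M φ = s * pairing ρ φ := by
      change ∑ i, (lam i : ℂ) * (tensorId φ (σ i) * M i).trace = _
      simp only [h1, lam, Finset.sum_const, Finset.card_univ, Fintype.card_fin, nsmul_eq_mul]
      push_cast
      rw [mul_inv_cancel_left₀ hkC]
    rw [h2, Complex.re_ofReal_mul]
  have hopt : optSuccProb lam σ ≤ s * dualNorm ρ := by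
    obtain ⟨N₀, hN₀⟩ : ∃ N : Fin k → Matrix (r × b) (r × b) ℂ, IsMeasurement N := by
      refine ⟨fun i => if i = ⟨0, hk⟩ then 1 else 0, fun i => ?_, by simp⟩
      dsimp only
      split_ifs
      exacts [.one, .zero]
    refine csSup_le ⟨_, N₀, hN₀, rfl⟩ ?_
    rintro t ⟨N, hN, rfl⟩
    -- Rotating each effect back turns the success probability into `Tr[ρ L] / k`. Since `ptrace L =
    -- d • 1`, the operator `Lᵀ / d` is the Choi operator of a channel, so any measurement scores
    -- `s` times a pairing of `ρ` with a channel.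
    set L : Matrix (r × b) (r × b) ℂ := ∑ i, conjSnd (U i).conjTranspose (N i) with hL
    have hLpos : L.PosSemidef := Matrix.posSemidef_sum _ fun i _ => conjSnd_posSemidef _ (hN.1 i)
    have hLtr : ptrace L = (Fintype.card b : ℂ) • 1 := by
      have h1 : ∀ i, ptrace (conjSnd (U i).conjTranspose (N i)) = ptrace (N i) := fun i =>
        ptrace_conjSnd (by
          rw [Matrix.conjTranspose_conjTranspose]
          exact mul_eq_one_comm.mp (hU i)) _
      rw [hL, map_sum, Finset.sum_congr rfl fun i _ => h1 i, ← map_sum, hN.2]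
      ext i j
      simp [ptrace_apply, Matrix.one_apply]
    have hβ : IsChannel (choi.symm ((Fintype.card b : ℂ)⁻¹ • L.transpose) : MatMap r b) := by
      rw [isChannel_iff, choi.apply_symm_apply]
      refine ⟨hLpos.transpose.smul (by positivity), ?_⟩
      have h1 : ptrace L.transpose = (ptrace L).transpose := rfl
      rw [map_smul, h1, hLtr, Matrix.transpose_smul, Matrix.transpose_one, inv_smul_smul₀ hdC]
    have h2 := re_pairing_le_dualNorm hρ.1 hβ
    have h3 : succProb lam σ N = s * (pairing ρ
        (choi.symm ((Fintype.card b : ℂ)⁻¹ • L.transpose) : MatMap r b)).re := by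
      have h4 : succProb lam σ N = (k : ℝ)⁻¹ * (ρ * L).trace.re := by
        simp only [succProb, lam, σ, trace_conjSnd_mul]
        rw [← Finset.mul_sum, hL, Matrix.mul_sum, Matrix.trace_sum, Complex.re_sum]
      have h5 : ((Fintype.card b : ℂ)⁻¹ • (ρ * L).trace).re = d⁻¹ * (ρ * L).trace.re := by
        rw [smul_eq_mul, ← Complex.re_ofReal_mul, hd]
        push_cast
        rfl
      rw [h4, pairing_eq_trace, choi.apply_symm_apply, Matrix.transpose_smul,
        Matrix.transpose_transpose, Matrix.mul_smul, Matrix.trace_smul, h5, hs]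
      field_simp
    rw [h3]
    exact mul_le_mul_of_nonneg_left h2 hs0.le
  have hpre₁ : preSuccProb Φ₁ M lam σ ≤ s * dualNorm (idTensor (transposeMap Φ₁) ρ) := by
    obtain ⟨α₀, hα₀⟩ := exists_isChannel (a := r) (b := a)
    rw [preSuccProb_eq_sSup]
    refine csSup_le ⟨_, α₀, hα₀, rfl⟩ ?_
    rintro t ⟨α, hα, rfl⟩
    rw [hgame]
    exact mul_le_mul_of_nonneg_left (re_pairing_comp_le_dualNorm hΦ₁ hρ.1 hα) hs0.le
  have hmain := h k lam σ M hE hM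
  obtain ⟨α₀, hα₀⟩ := exists_isChannel (a := r) (b := a')
  rw [dualNorm_idTensor_eq hΦ₂ hρ.1]
  refine csSup_le ⟨_, α₀, hα₀, rfl⟩ ?_
  rintro t ⟨α, hα, rfl⟩
  have h1 := re_gameLin_comp_le_preSuccProb Φ₂ M lam σ hα
  rw [hgame] at h1
  have h2 := mul_le_mul_of_nonneg_left hopt hc
  refine le_of_mul_le_mul_left ?_ hs0
  linarith

end Twirl

end QChan

end

theorem theorem6 {A₀ A₀' A₁ : Type u}
    [Fintype A₀] [DecidableEq A₀] [Nonempty A₀]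
    [Fintype A₀'] [DecidableEq A₀'] [Nonempty A₀']
    [Fintype A₁] [DecidableEq A₁] [Nonempty A₁]
    (Φ₁ : QChan.MatMap A₀ A₁) (hΦ₁ : QChan.IsChannel Φ₁)
    (Φ₂ : QChan.MatMap A₀' A₁) (hΦ₂ : QChan.IsChannel Φ₂)
    (ε : ℝ) (hε : 0 ≤ ε) :
    -- the minimum defining the deficiency is attained
    IsLeast (QChan.preDistances Φ₁ Φ₂) (QChan.deltaPre Φ₁ Φ₂) ∧
    List.TFAE [
      -- (i)
      QChan.deltaPre Φ₁ Φ₂ ≤ ε,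
      -- (ii)
      ∀ (R₀ : Type u) [Fintype R₀] (ρ : Matrix (R₀ × A₁) (R₀ × A₁) ℂ),
        QChan.IsState ρ →
          QChan.dualNorm (QChan.idTensor (QChan.transposeMap Φ₂) ρ) ≤
            QChan.dualNorm (QChan.idTensor (QChan.transposeMap Φ₁) ρ)
              + ε / 2 * QChan.dualNorm ρ,
      -- (iii)
      ∀ (R₀ : Type u) [Fintype R₀] [DecidableEq R₀] (k : ℕ)
        (lam : Fin k → ℝ) (ρ : Fin k → Matrix (R₀ × A₁) (R₀ × A₁) ℂ)
        (M : Fin k → Matrix (A₁ × A₁) (A₁ × A₁) ℂ),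
        QChan.IsEnsemble lam ρ → QChan.IsMeasurement M →
          QChan.preSuccProb Φ₂ M lam ρ ≤
            QChan.preSuccProb Φ₁ M lam ρ + ε / 2 * QChan.optSuccProb lam ρ,
      -- (ii) with the ancilla `A₀'` only
      ∀ ρ : Matrix (A₀' × A₁) (A₀' × A₁) ℂ,
        QChan.IsState ρ →
          QChan.dualNorm (QChan.idTensor (QChan.transposeMap Φ₂) ρ) ≤
            QChan.dualNorm (QChan.idTensor (QChan.transposeMap Φ₁) ρ)
              + ε / 2 * QChan.dualNorm ρ,
      -- (iii) with the ancilla `A₀'` only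
      ∀ (k : ℕ) (lam : Fin k → ℝ) (ρ : Fin k → Matrix (A₀' × A₁) (A₀' × A₁) ℂ)
        (M : Fin k → Matrix (A₁ × A₁) (A₁ × A₁) ℂ),
        QChan.IsEnsemble lam ρ → QChan.IsMeasurement M →
          QChan.preSuccProb Φ₂ M lam ρ ≤
            QChan.preSuccProb Φ₁ M lam ρ + ε / 2 * QChan.optSuccProb lam ρ] := by
  have hc : 0 ≤ ε / 2 := by linarith
  refine ⟨QChan.isLeast_deltaPre hΦ₁ hΦ₂, ?_⟩
  have hiff := QChan.deltaPre_le_iff hΦ₁ hΦ₂ hε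
  tfae_have 1 → 2 := fun h R₀ _ ρ hρ =>
    (hiff.mp h).dualNorm_le hΦ₁.1 hΦ₂.1 hc hρ.1
  tfae_have 1 → 3 := fun h R₀ _ _ k lam ρ M hE hM =>
    (hiff.mp h).preSuccProb_le hc hE hM
  tfae_have 2 → 4 := fun h ρ hρ => h A₀' ρ hρ
  tfae_have 3 → 5 := fun h k lam ρ M hE hM => h A₀' k lam ρ M hE hM
  tfae_have 5 → 4 := fun h ρ hρ =>
    QChan.dualNorm_le_of_preSuccProb_le hΦ₁.1 hΦ₂.1 hc h hρ
  tfae_have 4 → 1 := fun h => hiff.mpr (QChan.dominatedUpTo_of_dualNorm_le hΦ₁ hΦ₂ hc h)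
  tfae_finish
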